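/- **Setting.** Hilbert spaces are real and separable. Let $(Z,\mathcal Z,\nu)$ be a $\sigma$-finite measure space with $\mathcal Z$ countably generated; "$\nu$-measurable" means measurable with respect to the $\nu$-completion of $\mathcal Z$. A *$\nu$-measurable field of Hilbert spaces* $\zeta\mapsto H_\zeta$ with underlying space $S$ is a family of Hilbert spaces with a linear subspace $S\subset\prod_{\zeta}H_\zeta$ (the $\nu$-measurable vector fields) such that (a) $\zeta\mapsto\|u_\zeta\|_\zeta$ is $\nu$-measurable for all $u\in S$; (b) if $v\in\prod_\zeta H_\zeta$ and $\zeta\mapsto\langle u_\zeta,v_\zeta\rangle_\zeta$ is $\nu$-measurable for every $u\in S$, then $v\in S$; (c) there is a sequence $(u_n)_n\subset S$ such that $(u_{n,\zeta})_n$ is total in $H_\zeta$ for every $\zeta\in Z$. Its *direct integral* $\int_Z^{S}H_\zeta\,d\nu(\zeta)$ is the space of $u\in S$ with $\|u\|^2=\int_Z\|u_\zeta\|_\zeta^2\,d\nu(\zeta)<\infty$, modulo $\|u-v\|=0$. A field of bounded operators $B_\zeta$ on $H_\zeta$ is *$\nu$-measurable* if $\zeta\mapsto B_\zeta u_\zeta$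 is in $S$ for every $u\in S$; if moreover $\nu\text{-}\operatorname{ess\,sup}_\zeta\|B_\zeta\|<\infty$, then $\int_Z^{S} B_\zeta\,d\nu(\zeta)$ denotes the bounded operator sending the class of $u$ to the class of $\zeta\mapsto B_\zeta u_\zeta$. A *quadratic form* is a symmetric, positive semi-definite bilinear form $(Q,D)$ on a linear subspace $D$ of a Hilbert space $H$; set $Q_1(u,v)=Q(u,v)+\langle u,v\rangle$. It is *closed* if $D$ is complete for $Q_1^{1/2}$, and *closable* if $Q(u_n)\to0$ for every $Q^{1/2}$-Cauchy sequence $(u_n)_n\subset D$ with $u_n\to0$ in $H$. For a closable form, the completion of $D$ for $Q_1^{1/2}$ is identified with a subspace of $H$, the domain of the closure. The generator $L$ of a densely defined closed form $(Q,\operatorname{dom}Q)$ is given by: $u\in\operatorname{dom}L$ and $Lu=w$ if and only if $u\in\operatorname{dom}Q$ and $Q(u,v)=\langle-w,v\rangle$ for all $v\in\operatorname{dom}Q$. Its resolvent is $G_\alpha=(\alpha-L)^{-1}$, $\alpha>0$, and its semigroup $T_t=e^{tL}$, $t\ge 0$, is the strongly continuous contraction semigroup with generator $L$. For every $\zeta\in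 Z$ let $(Q_\zeta,D_\zeta)$ be a densely defined closable quadratic form on a Hilbert space $H_\zeta$, with closure $(Q_\zeta,\operatorname{dom}Q_\zeta)$, resolvent $G_{\zeta,\alpha}$ and semigroup $T_{\zeta,t}$ of the closure, and write $(\operatorname{dom}Q_\zeta)_1$ for $\operatorname{dom}Q_\zeta$ with the inner product $Q_{\zeta,1}$. Assume that $\zeta\mapsto H_\zeta$ is a $\nu$-measurable field of Hilbert spaces with underlying space $S_H$, that $\zeta\mapsto(\operatorname{dom}Q_\zeta)_1$ is a $\nu$-measurable field of Hilbert spaces with underlying space $S_Q$, and that $S_Q\subset S_H$ under the inclusions $\operatorname{dom}Q_\zeta\subset H_\zeta$. On $H=\int_Z^{S_H}H_\zeta\,d\nu(\zeta)$ define $$\operatorname{dom}Q=\Big\{[\hat u]:\hat u\in S_Q,\ \int_Z Q_{\zeta,1}(\hat u_\zeta,\hat u_\zeta)\,d\nu(\zeta)<\infty\Big\},\qquad Q(u,v)=\int_Z Q_\zeta(\hat u_\zeta,\hat v_\zeta)\,d\nu(\zeta),$$ where $\hat u,\hat v\in S_Q$ are representatives of $u,v\in\operatorname{dom}Q$ as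 in the definition of $\operatorname{dom}Q$. **Proposition 2.7.** With this notation: (i) $H$ is a Hilbert space, and $(Q,\operatorname{dom}Q)$ is a densely defined closed quadratic form on $H$; (ii) for all $\alpha,t>0$, the resolvents $G_{\zeta,\alpha}$ and semigroups $T_{\zeta,t}$ exist for every $\zeta\in Z$, and $\zeta\mapsto G_{\zeta,\alpha}$ and $\zeta\mapsto T_{\zeta,t}$ are $\nu$-measurable fields of bounded operators (with underlying space $S_H$); (iii) the resolvent $G_\alpha$ and the semigroup $T_t$ of $(Q,\operatorname{dom}Q)$ exist and, for all $\alpha,t>0$, these fields are $\nu$-essentially bounded and $$G_\alpha=\int_Z^{S_H}G_{\zeta,\alpha}\,d\nu(\zeta),\qquad T_t=\int_Z^{S_H}T_{\zeta,t}\,d\nu(\zeta).$$ -/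

import Mathlib

open MeasureTheory Filter Topology
open scoped NNReal

namespace DirInt

noncomputable section

/-! ## Quadratic forms on a real Hilbert space -/

/-- A quadratic form on `H`: a symmetric, positive semi-definite bilinear form on a linear
subspace of `H`. -/
structure QForm (H : Type*) [NormedAddCommGroup H] [InnerProductSpace ℝ H] where
  /-- the domain -/
  domain : Submodule ℝ H
  /-- the bilinear form -/
  form : domain →ₗ[ℝ] domain →ₗ[ℝ] ℝ
  symm : ∀ u v, form u v = form v u
  nonneg : ∀ u, 0 ≤ form u u

namespace QForm

section Basic

variable {H : Type*} [NormedAddCommGroup H] [InnerProductSpace ℝ H]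

/-- The form is densely defined. -/
def IsDenselyDefined (Q : QForm H) : Prop := Dense (Q.domain : Set H)

/-- The domain of `Q`, as a type of its own carrying the inner product
`Q₁(u, v) = Q(u, v) + ⟪u, v⟫`. -/
def Dom (Q : QForm H) : Type _ := Q.domain

instance (Q : QForm H) : AddCommGroup Q.Dom := inferInstanceAs (AddCommGroup Q.domain)

instance (Q : QForm H) : Module ℝ Q.Dom := inferInstanceAs (Module ℝ Q.domain)

/-- The identical inclusion of the domain of `Q` into `H`. -/
def incl (Q : QForm H) : Q.Dom →ₗ[ℝ] H := Q.domain.subtype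

/-- The bilinear form `Q` on its domain. -/
def bilin (Q : QForm H) : Q.Dom →ₗ[ℝ] Q.Dom →ₗ[ℝ] ℝ := Q.form

lemma incl_injective (Q : QForm H) : Function.Injective Q.incl := Subtype.val_injective

/-- The inner product `Q₁` on the domain of `Q`. -/
abbrev core (Q : QForm H) : InnerProductSpace.Core ℝ Q.Dom where
  inner u v := Q.bilin u v + inner ℝ (Q.incl u) (Q.incl v)
  conj_inner_symm u v := by
    have h : Q.bilin v u = Q.bilin u v := Q.symm v u
    simp [h, real_inner_comm]
  re_inner_nonneg u := by
    have h : 0 ≤ Q.bilin u u := Q.nonneg u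
    have h2 : 0 ≤ inner ℝ (Q.incl u) (Q.incl u) := real_inner_self_nonneg
    simpa using add_nonneg h h2
  add_left u v w := by
    simp only [map_add, LinearMap.add_apply, inner_add_left]; ring
  smul_left u v r := by
    simp only [map_smul, LinearMap.smul_apply, real_inner_smul_left, smul_eq_mul]
    simp; ring
  definite u h := by
    have h1 : 0 ≤ Q.bilin u u := Q.nonneg u
    have h2 : 0 ≤ inner ℝ (Q.incl u) (Q.incl u) := real_inner_self_nonneg
    have h' : Q.bilin u u + inner ℝ (Q.incl u) (Q.incl u) = 0 := h
    have h3 : inner ℝ (Q.incl u) (Q.incl u) = 0 := by linarith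
    apply Q.incl_injective
    rw [map_zero]
    exact inner_self_eq_zero.1 h3

instance (Q : QForm H) : NormedAddCommGroup Q.Dom := Q.core.toNormedAddCommGroup

instance (Q : QForm H) : InnerProductSpace ℝ Q.Dom := InnerProductSpace.ofCore Q.core.toCore

lemma inner_dom (Q : QForm H) (u v : Q.Dom) :
    inner ℝ u v = Q.bilin u v + inner ℝ (Q.incl u) (Q.incl v) := rfl

lemma norm_sq_dom (Q : QForm H) (u : Q.Dom) :
    ‖u‖ ^ 2 = Q.bilin u u + ‖Q.incl u‖ ^ 2 := by
  rw [← real_inner_self_eq_norm_sq, inner_dom, real_inner_self_eq_norm_sq]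

lemma norm_incl_le (Q : QForm H) (u : Q.Dom) : ‖Q.incl u‖ ≤ ‖u‖ := by
  have h : 0 ≤ Q.bilin u u := Q.nonneg u
  have := Q.norm_sq_dom u
  exact abs_le_of_sq_le_sq' (by linarith) (norm_nonneg _) |>.2

/-- The form is closed: its domain is complete for the norm `Q₁^{1/2}`. -/
def IsClosed (Q : QForm H) : Prop := CompleteSpace Q.Dom

/-- The form is closable: `Q(uₙ) → 0` for every `Q^{1/2}`-Cauchy sequence `uₙ` in the domain which
converges to `0` in `H`. -/
def IsClosable (Q : QForm H) : Prop :=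
  ∀ u : ℕ → Q.Dom,
    (∀ ε > 0, ∃ N, ∀ m ≥ N, ∀ n ≥ N, Q.bilin (u m - u n) (u m - u n) < ε) →
    Tendsto (fun n => Q.incl (u n)) atTop (𝓝 0) →
    Tendsto (fun n => Q.bilin (u n) (u n)) atTop (𝓝 0)

/-- The identical inclusion as a continuous linear map. -/
def inclL (Q : QForm H) : Q.Dom →L[ℝ] H :=
  Q.incl.mkContinuous 1 (fun u => by simpa using Q.norm_incl_le u)

end Basic

section Closure

variable {H : Type*} [NormedAddCommGroup H] [InnerProductSpace ℝ H] [CompleteSpace H]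

/-- The continuous extension of the identical inclusion to the completion of the domain of `Q` for
the norm `Q₁^{1/2}`. -/
def extIncl (Q : QForm H) : UniformSpace.Completion Q.Dom →L[ℝ] H :=
  Q.inclL.extend (UniformSpace.Completion.toComplL (𝕜 := ℝ) (E := Q.Dom))

lemma extIncl_coe (Q : QForm H) (u : Q.Dom) :
    Q.extIncl (u : UniformSpace.Completion Q.Dom) = Q.incl u :=
  ContinuousLinearMap.extend_eq (e := UniformSpace.Completion.toComplL (𝕜 := ℝ) (E := Q.Dom)) _
    UniformSpace.Completion.denseRange_coe
    (UniformSpace.Completion.isUniformInducing_coe _) u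

lemma norm_extIncl_le (Q : QForm H) (x : UniformSpace.Completion Q.Dom) :
    ‖Q.extIncl x‖ ≤ ‖x‖ := by
  induction x using UniformSpace.Completion.induction_on with
  | hp => exact isClosed_le (Q.extIncl.continuous.norm) continuous_norm
  | ih a =>
    rw [extIncl_coe, UniformSpace.Completion.norm_coe]
    exact Q.norm_incl_le a

lemma IsClosable.extIncl_injective {Q : QForm H} (hQ : Q.IsClosable) :
    Function.Injective Q.extIncl := by
  rw [injective_iff_map_eq_zero]
  intro x hx
  obtain ⟨s, hs, hsx⟩ := mem_closure_iff_seq_limit.1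
    ((UniformSpace.Completion.denseRange_coe (α := Q.Dom)).closure_eq ▸ Set.mem_univ x :
      x ∈ closure (Set.range ((↑) : Q.Dom → UniformSpace.Completion Q.Dom)))
  choose u hu using hs
  have hux : Tendsto (fun n => (u n : UniformSpace.Completion Q.Dom)) atTop (𝓝 x) := by
    simpa only [hu] using hsx
  have hc : CauchySeq u := by
    have := hux.cauchySeq
    rw [Metric.cauchySeq_iff] at this ⊢
    simpa [dist_eq_norm, ← UniformSpace.Completion.coe_sub] using this
  have hi : Tendsto (fun n => Q.incl (u n)) atTop (𝓝 0) := by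
    have := (Q.extIncl.continuous.tendsto x).comp hux
    rw [hx] at this
    refine this.congr fun n => ?_
    simp [extIncl_coe]
  have hQ0 := hQ u ?_ hi
  · have hn : Tendsto (fun n => ‖u n‖ ^ 2) atTop (𝓝 0) := by
      have := hQ0.add (hi.norm.pow 2)
      simpa [norm_sq_dom] using this
    have hn2 : Tendsto (fun n => ‖(u n : UniformSpace.Completion Q.Dom)‖ ^ 2) atTop
        (𝓝 (‖x‖ ^ 2)) := hux.norm.pow 2
    simp only [UniformSpace.Completion.norm_coe] at hn2
    have := tendsto_nhds_unique hn2 hn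
    simpa using this
  · intro ε hε
    obtain ⟨N, hN⟩ := Metric.cauchySeq_iff.1 hc (Real.sqrt ε) (Real.sqrt_pos.2 hε)
    refine ⟨N, fun m hm n hn => ?_⟩
    have h1 := hN m hm n hn
    rw [dist_eq_norm, Real.lt_sqrt (norm_nonneg _), norm_sq_dom] at h1
    have h2 := sq_nonneg ‖Q.incl (u m - u n)‖
    linarith

/-- The completion of the domain of a closable form, as a linear subspace of `H`. -/
def closureEquiv (Q : QForm H) (hQ : Q.IsClosable) :
    UniformSpace.Completion Q.Dom ≃ₗ[ℝ]
      LinearMap.range (Q.extIncl : UniformSpace.Completion Q.Dom →ₗ[ℝ] H) :=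
  LinearEquiv.ofInjective (Q.extIncl : UniformSpace.Completion Q.Dom →ₗ[ℝ] H)
    hQ.extIncl_injective

lemma closureEquiv_symm_apply (Q : QForm H) (hQ : Q.IsClosable)
    (u : LinearMap.range (Q.extIncl : UniformSpace.Completion Q.Dom →ₗ[ℝ] H)) :
    Q.extIncl ((Q.closureEquiv hQ).symm u) = u :=
  congrArg Subtype.val ((Q.closureEquiv hQ).apply_symm_apply u)

/-- The closure of a closable form: its domain is the completion of the domain of `Q` for the norm
`Q₁^{1/2}`, seen as a subspace of `H`, and on it `Q(u, v) = Q₁(u, v) - ⟪u, v⟫`. -/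
def closure (Q : QForm H) (hQ : Q.IsClosable) : QForm H where
  domain := LinearMap.range (Q.extIncl : UniformSpace.Completion Q.Dom →ₗ[ℝ] H)
  form := LinearMap.mk₂ ℝ
    (fun u v => inner ℝ ((Q.closureEquiv hQ).symm u) ((Q.closureEquiv hQ).symm v)
      - inner ℝ (u : H) (v : H))
    (fun u v w => by simp only [map_add, inner_add_left, Submodule.coe_add]; ring)
    (fun r u v => by
      simp only [map_smul, real_inner_smul_left, Submodule.coe_smul, smul_eq_mul]; ring)
    (fun u v w => by simp only [map_add, inner_add_right, Submodule.coe_add]; ring)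
    (fun r u v => by
      simp only [map_smul, real_inner_smul_right, Submodule.coe_smul, smul_eq_mul]; ring)
  symm u v := by simp [real_inner_comm]
  nonneg u := by
    have h := Q.norm_extIncl_le ((Q.closureEquiv hQ).symm u)
    rw [closureEquiv_symm_apply] at h
    simp only [LinearMap.mk₂_apply, real_inner_self_eq_norm_sq]
    have := pow_le_pow_left₀ (norm_nonneg _) h 2
    linarith

end Closure

section Operators

variable {H : Type*} [NormedAddCommGroup H] [InnerProductSpace ℝ H]

/-- The graph of the generator `L` of `Q`: `u ∈ dom L` and `L u = w` iff `u ∈ dom Q` and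
`Q(u, v) = ⟪-w, v⟫` for all `v ∈ dom Q`. -/
def IsGenerator (Q : QForm H) (u w : H) : Prop :=
  ∃ hu : u ∈ Q.domain, ∀ v : Q.domain, Q.form ⟨u, hu⟩ v = inner ℝ (-w) (v : H)

/-- `G` is the bounded inverse `(α - L)⁻¹`. -/
def IsResolvent (Q : QForm H) (α : ℝ) (G : H →L[ℝ] H) : Prop :=
  (∀ f : H, Q.IsGenerator (G f) (α • G f - f)) ∧
  (∀ u w : H, Q.IsGenerator u w → G (α • u - w) = u)

/-- `T` is the strongly continuous contraction semigroup with infinitesimal generator `L`, that is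
`T t = e^{tL}`. -/
structure IsSemigroup (Q : QForm H) (T : ℝ≥0 → H →L[ℝ] H) : Prop where
  zero : T 0 = ContinuousLinearMap.id ℝ H
  add : ∀ s t, T (s + t) = (T s).comp (T t)
  contraction : ∀ t, ‖T t‖ ≤ 1
  continuous : ∀ u, Continuous fun t => T t u
  generator : ∀ u w, Q.IsGenerator u w ↔
    Tendsto (fun t : ℝ≥0 => (t : ℝ)⁻¹ • (T t u - u)) (𝓝[>] 0) (𝓝 w)

/-- The resolvent `G_α = (α - L)⁻¹` of `Q`, for `α > 0`. -/
def resolvent (Q : QForm H) (α : ℝ) : H →L[ℝ] H := Classical.epsilon (Q.IsResolvent α)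

/-- The semigroup `T_t = e^{tL}` of `Q`. -/
def semigroup (Q : QForm H) : ℝ≥0 → H →L[ℝ] H := Classical.epsilon Q.IsSemigroup

end Operators

end QForm

/-! ## Measurable fields of Hilbert spaces and their direct integrals -/

section Fields

variable {Z : Type*} [MeasurableSpace Z]

/-- The field `ζ ↦ E ζ` is a `ν`-measurable field of Hilbert spaces with underlying space `fields`.
A real function is `ν`-measurable, i.e. measurable for the completed σ-algebra, iff it is
`AEMeasurable`. -/
structure MeasurableField (ν : Measure Z) (E : Z → Type*) [∀ ζ, NormedAddCommGroup (E ζ)]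
    [∀ ζ, InnerProductSpace ℝ (E ζ)] where
  /-- the space of `ν`-measurable vector fields -/
  fields : Submodule ℝ (∀ ζ, E ζ)
  aemeasurable_norm : ∀ u ∈ fields, AEMeasurable (fun ζ => ‖u ζ‖) ν
  mem_of_aemeasurable_inner : ∀ v : ∀ ζ, E ζ,
    (∀ u ∈ fields, AEMeasurable (fun ζ => inner ℝ (u ζ) (v ζ)) ν) → v ∈ fields
  exists_fundamental : ∃ u : ℕ → ∀ ζ, E ζ, (∀ n, u n ∈ fields) ∧
    ∀ ζ, Dense (Submodule.span ℝ (Set.range fun n => u n ζ) : Set (E ζ))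

namespace MeasurableField

variable {ν : Measure Z} {E : Z → Type*} [∀ ζ, NormedAddCommGroup (E ζ)]
  [∀ ζ, InnerProductSpace ℝ (E ζ)]

/-- The `ν`-measurable, `ν`-square-integrable vector fields. -/
def sqIntegrable (M : MeasurableField ν E) : Submodule ℝ (∀ ζ, E ζ) where
  carrier := {u | u ∈ M.fields ∧ Integrable (fun ζ => ‖u ζ‖ ^ 2) ν}
  zero_mem' := ⟨M.fields.zero_mem, by simp⟩
  add_mem' := by
    rintro u v ⟨hu, hu2⟩ ⟨hv, hv2⟩
    have huv := M.fields.add_mem hu hv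
    refine ⟨huv, ((hu2.const_mul 2).add (hv2.const_mul 2)).mono'
      ((M.aemeasurable_norm _ huv).pow_const 2).aestronglyMeasurable (ae_of_all _ fun ζ => ?_)⟩
    have h1 := norm_add_le (u ζ) (v ζ)
    have h2 := pow_le_pow_left₀ (norm_nonneg _) h1 2
    simp only [Pi.add_apply, Real.norm_eq_abs, abs_of_nonneg (sq_nonneg ‖u ζ + v ζ‖)]
    nlinarith [sq_nonneg (‖u ζ‖ - ‖v ζ‖)]
  smul_mem' := by
    rintro r u ⟨hu, hu2⟩
    refine ⟨M.fields.smul_mem r hu, ?_⟩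
    simpa [norm_smul, mul_pow] using hu2.const_mul (r ^ 2)

/-- The square-integrable vector fields, as a type of its own carrying the semi-inner product
`∫ ⟪u_ζ, v_ζ⟫ dν(ζ)`. -/
def SqInt (M : MeasurableField ν E) : Type _ := M.sqIntegrable

instance (M : MeasurableField ν E) : AddCommGroup M.SqInt :=
  inferInstanceAs (AddCommGroup M.sqIntegrable)

instance (M : MeasurableField ν E) : Module ℝ M.SqInt :=
  inferInstanceAs (Module ℝ M.sqIntegrable)

/-- The vector field underlying an element of `M.SqInt`. -/
def val (M : MeasurableField ν E) : M.SqInt →ₗ[ℝ] ∀ ζ, E ζ := M.sqIntegrable.subtype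

lemma aemeasurable_inner (M : MeasurableField ν E) {u v : ∀ ζ, E ζ} (hu : u ∈ M.fields)
    (hv : v ∈ M.fields) : AEMeasurable (fun ζ => inner ℝ (u ζ) (v ζ)) ν := by
  have h1 := M.aemeasurable_norm _ (M.fields.add_mem hu hv)
  have h2 := M.aemeasurable_norm _ (M.fields.sub_mem hu hv)
  refine (((h1.pow_const 2).sub (h2.pow_const 2)).div_const 4).congr (ae_of_all _ fun ζ => ?_)
  have h3 := norm_add_sq_real (u ζ) (v ζ)
  have h4 := norm_sub_sq_real (u ζ) (v ζ)
  simp only [Pi.add_apply, Pi.sub_apply, h3, h4]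
  ring

lemma integrable_inner (M : MeasurableField ν E) (u v : M.SqInt) :
    Integrable (fun ζ => inner ℝ (M.val u ζ) (M.val v ζ)) ν := by
  refine (u.2.2.add v.2.2).mono'
    (M.aemeasurable_inner u.2.1 v.2.1).aestronglyMeasurable (ae_of_all _ fun ζ => ?_)
  have h := abs_real_inner_le_norm (M.val u ζ) (M.val v ζ)
  rw [Real.norm_eq_abs]
  refine h.trans ?_
  change ‖M.val u ζ‖ * ‖M.val v ζ‖ ≤ ‖M.val u ζ‖ ^ 2 + ‖M.val v ζ‖ ^ 2
  nlinarith [sq_nonneg (‖M.val u ζ‖ - ‖M.val v ζ‖), sq_nonneg ‖M.val u ζ‖,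
    sq_nonneg ‖M.val v ζ‖]

/-- The semi-inner product of square-integrable vector fields. -/
abbrev core (M : MeasurableField ν E) : PreInnerProductSpace.Core ℝ M.SqInt where
  inner u v := ∫ ζ, inner ℝ (M.val u ζ) (M.val v ζ) ∂ν
  conj_inner_symm u v := by simp [real_inner_comm]
  re_inner_nonneg u := by
    change 0 ≤ ∫ ζ, inner ℝ (M.val u ζ) (M.val u ζ) ∂ν
    exact integral_nonneg fun ζ => real_inner_self_nonneg
  add_left u v w := by
    simp only [map_add, Pi.add_apply, inner_add_left]
    exact integral_add (M.integrable_inner u w) (M.integrable_inner v w)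
  smul_left u v r := by
    simp only [map_smul, Pi.smul_apply, real_inner_smul_left]
    simpa using integral_const_mul r _

instance (M : MeasurableField ν E) : SeminormedAddCommGroup M.SqInt :=
  @InnerProductSpace.Core.toSeminormedAddCommGroup ℝ M.SqInt _ _ _ M.core

instance (M : MeasurableField ν E) : InnerProductSpace ℝ M.SqInt := InnerProductSpace.ofCore M.core

lemma inner_sqInt (M : MeasurableField ν E) (u v : M.SqInt) :
    inner ℝ u v = ∫ ζ, inner ℝ (M.val u ζ) (M.val v ζ) ∂ν := rfl

lemma norm_sq_sqInt (M : MeasurableField ν E) (u : M.SqInt) :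
    ‖u‖ ^ 2 = ∫ ζ, ‖M.val u ζ‖ ^ 2 ∂ν := by
  rw [← real_inner_self_eq_norm_sq, inner_sqInt]
  simp only [real_inner_self_eq_norm_sq]

/-- The direct integral of the field: square-integrable vector fields `u`, `v` are identified if
`‖u - v‖ = 0`. -/
def DirectIntegral (M : MeasurableField ν E) : Type _ := SeparationQuotient M.SqInt

instance (M : MeasurableField ν E) : NormedAddCommGroup M.DirectIntegral :=
  inferInstanceAs (NormedAddCommGroup (SeparationQuotient M.SqInt))

instance (M : MeasurableField ν E) : InnerProductSpace ℝ M.DirectIntegral :=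
  inferInstanceAs (InnerProductSpace ℝ (SeparationQuotient M.SqInt))

/-- The class of a square-integrable vector field in the direct integral. -/
def toDirectIntegral (M : MeasurableField ν E) : M.SqInt →ₗ[ℝ] M.DirectIntegral :=
  (SeparationQuotient.mkCLM ℝ M.SqInt : M.SqInt →ₗ[ℝ] SeparationQuotient M.SqInt)

lemma norm_toDirectIntegral (M : MeasurableField ν E) (u : M.SqInt) :
    ‖M.toDirectIntegral u‖ = ‖u‖ := SeparationQuotient.norm_mk u

lemma ae_eq_of_toDirectIntegral_eq (M : MeasurableField ν E) {u v : M.SqInt}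
    (h : M.toDirectIntegral u = M.toDirectIntegral v) : ∀ᵐ ζ ∂ν, M.val u ζ = M.val v ζ := by
  have h0 : ‖u - v‖ = 0 := by rw [← norm_toDirectIntegral, map_sub, h, sub_self, norm_zero]
  have h1 : ∫ ζ, ‖M.val (u - v) ζ‖ ^ 2 ∂ν = 0 := by rw [← norm_sq_sqInt, h0]; simp
  have h2 : Integrable (fun ζ => ‖M.val (u - v) ζ‖ ^ 2) ν := (u - v).2.2
  rw [integral_eq_zero_iff_of_nonneg (fun ζ => sq_nonneg _) h2] at h1
  filter_upwards [h1] with ζ hζ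
  have : M.val (u - v) ζ = 0 := by simpa using hζ
  rw [map_sub, Pi.sub_apply] at this
  exact sub_eq_zero.1 this

/-- `ζ ↦ B ζ` is a `ν`-measurable field of bounded operators. -/
def IsMeasurableOpField (M : MeasurableField ν E) (B : ∀ ζ, E ζ →L[ℝ] E ζ) : Prop :=
  ∀ u ∈ M.fields, (fun ζ => B ζ (u ζ)) ∈ M.fields

/-- The bounded operator `A` on the direct integral is decomposable, and it is the direct integral
of the `ν`-essentially bounded `ν`-measurable field `ζ ↦ B ζ`: for every square-integrable vector
field `u`, the field `ζ ↦ B ζ (u ζ)` represents `A u`. -/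
def IsDirectIntegralOp (M : MeasurableField ν E) (A : M.DirectIntegral →L[ℝ] M.DirectIntegral)
    (B : ∀ ζ, E ζ →L[ℝ] E ζ) : Prop :=
  M.IsMeasurableOpField B ∧ (∃ C : ℝ, ∀ᵐ ζ ∂ν, ‖B ζ‖ ≤ C) ∧
  ∀ u : M.SqInt, ∃ v : M.SqInt, (∀ ζ, M.val v ζ = B ζ (M.val u ζ)) ∧
    A (M.toDirectIntegral u) = M.toDirectIntegral v

end MeasurableField

/-! ## Direct integrals of quadratic forms -/

/-- A `ν`-measurable field of quadratic forms `ζ ↦ (q ζ, D ζ)`: each `q ζ` is densely defined and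
closable, `ζ ↦ H ζ` and `ζ ↦ dom(Q ζ)₁`, where `Q ζ` is the closure of `q ζ`, are `ν`-measurable
fields of Hilbert spaces, and the `ν`-measurable fields for the latter are `ν`-measurable for the
former. -/
structure MeasurableFormField (ν : Measure Z) {H : Z → Type*} [∀ ζ, NormedAddCommGroup (H ζ)]
    [∀ ζ, InnerProductSpace ℝ (H ζ)] [∀ ζ, CompleteSpace (H ζ)] (q : ∀ ζ, QForm (H ζ)) where
  dense : ∀ ζ, (q ζ).IsDenselyDefined
  closable : ∀ ζ, (q ζ).IsClosable
  /-- the underlying space of `ζ ↦ H ζ` -/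
  fieldH : MeasurableField ν H
  /-- the underlying space of `ζ ↦ dom(Q ζ)₁` -/
  fieldQ : MeasurableField ν fun ζ => ((q ζ).closure (closable ζ)).Dom
  le : ∀ u ∈ fieldQ.fields, (fun ζ => ((q ζ).closure (closable ζ)).incl (u ζ)) ∈ fieldH.fields

namespace MeasurableFormField

variable {ν : Measure Z} {H : Z → Type*} [∀ ζ, NormedAddCommGroup (H ζ)]
  [∀ ζ, InnerProductSpace ℝ (H ζ)] [∀ ζ, CompleteSpace (H ζ)] {q : ∀ ζ, QForm (H ζ)}

/-- The closure `(Q ζ, dom(Q ζ))` of `q ζ`. -/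
abbrev Q (F : MeasurableFormField ν q) (ζ : Z) : QForm (H ζ) := (q ζ).closure (F.closable ζ)

/-- A vector field in `fieldQ` with `∫ Q_{ζ,1}(u_ζ) dν(ζ) < ∞` is a square-integrable field of
vectors of `H ζ`. -/
def inclSqInt (F : MeasurableFormField ν q) : F.fieldQ.SqInt →ₗ[ℝ] F.fieldH.SqInt where
  toFun u := ⟨fun ζ => (F.Q ζ).incl (F.fieldQ.val u ζ), by
    have hm := F.le _ u.2.1
    refine ⟨hm, u.2.2.mono' ((F.fieldH.aemeasurable_norm _ hm).pow_const 2).aestronglyMeasurable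
      (ae_of_all _ fun ζ => ?_)⟩
    rw [Real.norm_of_nonneg (sq_nonneg _)]
    exact pow_le_pow_left₀ (norm_nonneg _)
      ((F.Q ζ).norm_incl_le (F.fieldQ.val u ζ)) 2⟩
  map_add' u v := Subtype.ext (by ext ζ; simp; rfl)
  map_smul' r u := Subtype.ext (by ext ζ; simp; rfl)

lemma val_inclSqInt (F : MeasurableFormField ν q) (u : F.fieldQ.SqInt) (ζ : Z) :
    F.fieldH.val (F.inclSqInt u) ζ = (F.Q ζ).incl (F.fieldQ.val u ζ) := rfl

lemma integrable_bilin (F : MeasurableFormField ν q) (u v : F.fieldQ.SqInt) :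
    Integrable (fun ζ => (F.Q ζ).bilin (F.fieldQ.val u ζ) (F.fieldQ.val v ζ)) ν := by
  refine ((F.fieldQ.integrable_inner u v).sub
    (F.fieldH.integrable_inner (F.inclSqInt u) (F.inclSqInt v))).congr (ae_of_all _ fun ζ => ?_)
  simp [QForm.inner_dom, val_inclSqInt]

/-- The space of classes in the direct integral of `ζ ↦ H ζ` of the fields `u` in `fieldQ` with
`∫ Q_{ζ,1}(u_ζ) dν(ζ) < ∞`. -/
def domain (F : MeasurableFormField ν q) : Submodule ℝ F.fieldH.DirectIntegral :=
  LinearMap.range (F.fieldH.toDirectIntegral ∘ₗ F.inclSqInt)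

/-- A representative in `fieldQ` of an element of the domain. -/
def rep (F : MeasurableFormField ν q) (u : F.domain) : F.fieldQ.SqInt := Classical.choose u.2

lemma rep_spec (F : MeasurableFormField ν q) (u : F.domain) :
    F.fieldH.toDirectIntegral (F.inclSqInt (F.rep u)) = u := Classical.choose_spec u.2

/-- Representatives are unique up to equality `ν`-almost everywhere. -/
lemma ae_eq_rep (F : MeasurableFormField ν q) {u : F.domain} {w : F.fieldQ.SqInt}
    (h : F.fieldH.toDirectIntegral (F.inclSqInt w) = u) :
    ∀ᵐ ζ ∂ν, F.fieldQ.val (F.rep u) ζ = F.fieldQ.val w ζ := by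
  have := F.fieldH.ae_eq_of_toDirectIntegral_eq ((F.rep_spec u).trans h.symm)
  filter_upwards [this] with ζ hζ
  exact (F.Q ζ).incl_injective hζ

lemma rep_add (F : MeasurableFormField ν q) (u v : F.domain) : ∀ᵐ ζ ∂ν,
    F.fieldQ.val (F.rep (u + v)) ζ = F.fieldQ.val (F.rep u) ζ + F.fieldQ.val (F.rep v) ζ := by
  have := F.ae_eq_rep (u := u + v) (w := F.rep u + F.rep v) (by simp [rep_spec])
  simpa using this

lemma rep_smul (F : MeasurableFormField ν q) (r : ℝ) (u : F.domain) : ∀ᵐ ζ ∂ν,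
    F.fieldQ.val (F.rep (r • u)) ζ = r • F.fieldQ.val (F.rep u) ζ := by
  have := F.ae_eq_rep (u := r • u) (w := r • F.rep u) (by simp [rep_spec])
  simpa using this

/-- The direct integral of quadratic forms, `Q(u, v) = ∫ Q_ζ(u_ζ, v_ζ) dν(ζ)`. -/
def directIntegral (F : MeasurableFormField ν q) : QForm F.fieldH.DirectIntegral where
  domain := F.domain
  form := LinearMap.mk₂ ℝ
    (fun u v => ∫ ζ, (F.Q ζ).bilin (F.fieldQ.val (F.rep u) ζ) (F.fieldQ.val (F.rep v) ζ) ∂ν)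
    (fun u v w => by
      rw [← integral_add (F.integrable_bilin _ _) (F.integrable_bilin _ _)]
      refine integral_congr_ae ?_
      filter_upwards [F.rep_add u v] with ζ hζ
      simp [hζ])
    (fun r u v => by
      rw [smul_eq_mul, ← integral_const_mul]
      refine integral_congr_ae ?_
      filter_upwards [F.rep_smul r u] with ζ hζ
      simp [hζ])
    (fun u v w => by
      rw [← integral_add (F.integrable_bilin _ _) (F.integrable_bilin _ _)]
      refine integral_congr_ae ?_
      filter_upwards [F.rep_add v w] with ζ hζ
      simp [hζ])
    (fun r u v => by
      rw [smul_eq_mul, ← integral_const_mul]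
      refine integral_congr_ae ?_
      filter_upwards [F.rep_smul r v] with ζ hζ
      simp [hζ])
  symm u v := integral_congr_ae (ae_of_all _ fun ζ => (F.Q ζ).symm _ _)
  nonneg u := integral_nonneg fun ζ => (F.Q ζ).nonneg _

end MeasurableFormField

end Fields

end

end DirInt

/-! Measurability has a variational source. For a measurable field `f`, the field `x = G_{ζ,1} f`
satisfies `Q_{ζ,1}(x, v) = ⟪f, v⟫` for all `v` in the form domain. Thus `x` has measurable inner
products with every field of `S_Q`, so axiom (b) puts it in `S_Q`, and `S_Q ⊆ S_H` puts it in `S_H`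
(`exists_mem_fields_of_isGenerator`). A contraction iteration carries measurability from `G_1` to
every `G_α`.

Fibrewise solutions of the resolvent equation are also solutions for the integrated form
(`isGenerator_directIntegral`, `exists_resolvent_val`). Density follows: if `f` is orthogonal to the
domain then `∫ ⟪G_{ζ,1} f, f⟫ = 0`, and the integrand dominates `‖G_{ζ,1} f‖²`, so `G_{ζ,1} f`, and
hence `f`, vanishes almost everywhere. Closedness is Riesz–Fischer for the field `ζ ↦ (dom Q_ζ)₁`,
whose square-integrable fields map onto the domain of `Q` preserving the norm. Lax–Milgram then
gives `G_α`, and uniqueness of solutions identifies it with the direct integral of the `G_{ζ,α}`.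

The semigroup of any densely defined closed form is the strong limit of `exp(t A_n)`, with the
Yosida approximations `A_n = n(n G_n - 1)` (`tendsto_semigroup`). Decomposable operators are stable
under algebraic operations and under uniformly bounded strong limits
(`isDirectIntegralOp_of_tendsto`), so the identity for resolvents passes to `A_n`, to the
exponential series and finally to `T_t`. Resolvents and semigroups are unique, so the chosen ones
are those constructed here. -/

namespace DirInt

namespace QForm

/-! ### Generators and resolvents of quadratic forms -/

section Generator

variable {H : Type*} [NormedAddCommGroup H] [InnerProductSpace ℝ H] {Q : QForm H}

lemma bilin_symm (Q : QForm H) (u v : Q.Dom) : Q.bilin u v = Q.bilin v u := Q.symm u v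

lemma bilin_self_nonneg (Q : QForm H) (u : Q.Dom) : 0 ≤ Q.bilin u u := Q.nonneg u

lemma inclL_apply (Q : QForm H) (u : Q.Dom) : Q.inclL u = Q.incl u := rfl

/-- Moves the definition to `Q.Dom`, where the Hilbert space structure `Q₁` is available. -/
lemma isGenerator_iff {u w : H} : Q.IsGenerator u w ↔
    ∃ x : Q.Dom, Q.incl x = u ∧ ∀ v : Q.Dom, Q.bilin x v = inner ℝ (-w) (Q.incl v) := by
  constructor
  · rintro ⟨hu, h⟩
    exact ⟨⟨u, hu⟩, rfl, h⟩
  · rintro ⟨x, rfl, h⟩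
    exact ⟨x.2, h⟩

lemma IsGenerator.add {u w u' w' : H} (h : Q.IsGenerator u w) (h' : Q.IsGenerator u' w') :
    Q.IsGenerator (u + u') (w + w') := by
  rw [isGenerator_iff] at *
  obtain ⟨x, rfl, hx⟩ := h
  obtain ⟨y, rfl, hy⟩ := h'
  refine ⟨x + y, map_add _ _ _, fun v => ?_⟩
  simp only [map_add, LinearMap.add_apply, hx, hy, inner_add_left, inner_neg_left]
  ring

lemma IsGenerator.smul {u w : H} (r : ℝ) (h : Q.IsGenerator u w) :
    Q.IsGenerator (r • u) (r • w) := by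
  rw [isGenerator_iff] at *
  obtain ⟨x, rfl, hx⟩ := h
  refine ⟨r • x, map_smul _ _ _, fun v => ?_⟩
  simp [hx, inner_neg_left, real_inner_smul_left]

lemma IsGenerator.sub {u w u' w' : H} (h : Q.IsGenerator u w) (h' : Q.IsGenerator u' w') :
    Q.IsGenerator (u - u') (w - w') := by
  simpa [sub_eq_add_neg] using h.add (h'.smul (-1))

/-- The generator is dissipative. -/
lemma IsGenerator.inner_nonpos {u w : H} (h : Q.IsGenerator u w) : inner ℝ w u ≤ 0 := by
  obtain ⟨x, rfl, hx⟩ := isGenerator_iff.1 h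
  have h1 := hx x
  have h2 := Q.bilin_self_nonneg x
  rw [inner_neg_left] at h1
  linarith

/-- The generator is symmetric. -/
lemma IsGenerator.inner_comm {u w u' w' : H} (h : Q.IsGenerator u w) (h' : Q.IsGenerator u' w') :
    inner ℝ w u' = inner ℝ w' u := by
  obtain ⟨x, rfl, hx⟩ := isGenerator_iff.1 h
  obtain ⟨y, rfl, hy⟩ := isGenerator_iff.1 h'
  have h1 := hx y
  have h2 := hy x
  rw [bilin_symm, h1] at h2
  simpa [inner_neg_left] using h2

namespace IsResolvent

variable {α β : ℝ} {G G' : H →L[ℝ] H}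

lemma eq_of_isGenerator (hG : Q.IsResolvent α G) {u f : H} (h : Q.IsGenerator u (α • u - f)) :
    G f = u := by
  simpa using hG.2 _ _ h

lemma unique (hG : Q.IsResolvent α G) (hG' : Q.IsResolvent α G') : G = G' := by
  ext f
  exact hG.eq_of_isGenerator (hG'.1 f)

/-- Dissipativity at `G f` gives `α ‖G f‖² ≤ ⟪f, G f⟫`; Cauchy–Schwarz does the rest. -/
lemma mul_norm_le (hG : Q.IsResolvent α G) (f : H) : α * ‖G f‖ ≤ ‖f‖ := by
  have h := (hG.1 f).inner_nonpos
  rw [inner_sub_left, real_inner_smul_left, real_inner_self_eq_norm_sq] at h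
  have h2 := real_inner_le_norm f (G f)
  rcases (norm_nonneg (G f)).eq_or_lt with h0 | h0
  · rw [← h0]; simp
  · refine le_of_mul_le_mul_right ?_ h0
    nlinarith

lemma inner_comm (hG : Q.IsResolvent α G) (f g : H) : inner ℝ (G f) g = inner ℝ f (G g) := by
  have h := (hG.1 f).inner_comm (hG.1 g)
  simp only [inner_sub_left, real_inner_smul_left] at h
  rw [real_inner_comm (G f) (G g), real_inner_comm (G f) g] at h
  linarith

/-- Apply `G` to `(α - L) G' f = f + (α - β) G' f`. -/
lemma resolvent_identity (hG : Q.IsResolvent α G) (hG' : Q.IsResolvent β G') (f : H) :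
    G' f - G f = (α - β) • G (G' f) := by
  have h : G (α • G' f - (β • G' f - f)) = G' f := hG.2 _ _ (hG'.1 f)
  rw [← sub_add, ← sub_smul, map_add, map_smul] at h
  nth_rw 1 [← h]
  abel

lemma comm (hG : Q.IsResolvent α G) (hG' : Q.IsResolvent β G') : Commute G G' := by
  rcases eq_or_ne α β with rfl | hne
  · rw [hG.unique hG']
  · ext f
    have h1 := hG.resolvent_identity hG' f
    have h2 := hG'.resolvent_identity hG f
    have h3 : (α - β) • G (G' f) = (α - β) • G' (G f) := by
      rw [← h1, ← neg_sub, h2, ← neg_smul, neg_sub]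
    exact smul_right_injective _ (sub_ne_zero.2 hne) h3

end IsResolvent

lemma dense_incl (hd : Q.IsDenselyDefined) : DenseRange Q.incl := by
  have : Set.range Q.incl = (Q.domain : Set H) := Subtype.range_coe
  rw [DenseRange, this]
  exact hd

lemma eq_zero_of_inner_incl (hd : Q.IsDenselyDefined) {f : H}
    (h : ∀ v : Q.Dom, inner ℝ f (Q.incl v) = 0) : f = 0 := by
  have : (fun v : H => inner ℝ f v) = fun _ => 0 :=
    (dense_incl hd).equalizer (by fun_prop) continuous_const (funext h)
  exact inner_self_eq_zero.1 (congrFun this f)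

variable [CompleteSpace H]

/-- The resolvent of a closed form exists, by the Lax-Milgram theorem. -/
lemma exists_isResolvent (hQ : Q.IsClosed) {α : ℝ} (hα : 0 < α) :
    ∃ G, Q.IsResolvent α G := by
  have : CompleteSpace Q.Dom := hQ
  -- `Q + α⟪·,·⟫`, written as `Q₁ + (α - 1)⟪·,·⟫` to make its boundedness for the `Q₁`-norm evident.
  -- It is coercive with constant `min 1 α`.
  let B : Q.Dom →L[ℝ] Q.Dom →L[ℝ] ℝ :=
    innerSL ℝ + (α - 1) • ((innerSL ℝ).bilinearComp Q.inclL Q.inclL)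
  have hB : ∀ u v, B u v = Q.bilin u v + α * inner ℝ (Q.incl u) (Q.incl v) := fun u v => by
    change inner ℝ u v + (α - 1) * inner ℝ (Q.incl u) (Q.incl v) = _
    rw [inner_dom]
    ring
  have hc : IsCoercive B := by
    refine ⟨min 1 α, lt_min one_pos hα, fun u => ?_⟩
    have h1 := Q.bilin_self_nonneg u
    have h2 := sq_nonneg ‖Q.incl u‖
    have h3 := min_le_left 1 α
    have h4 := min_le_right 1 α
    rw [hB, mul_assoc, ← sq, norm_sq_dom, real_inner_self_eq_norm_sq]
    nlinarith
  let S := hc.continuousLinearEquivOfBilin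
  have hS : ∀ f (v : Q.Dom), Q.bilin (S.symm (ContinuousLinearMap.adjoint Q.inclL f)) v +
      α * inner ℝ (Q.incl (S.symm (ContinuousLinearMap.adjoint Q.inclL f))) (Q.incl v) =
      inner ℝ f (Q.incl v) := fun f v => by
    rw [← hB, ← hc.continuousLinearEquivOfBilin_apply]
    change inner ℝ (S (S.symm _)) v = _
    rw [S.apply_symm_apply, ContinuousLinearMap.adjoint_inner_left, inclL_apply]
  -- The adjoint of the inclusion sends `f` to the Riesz representative of `v ↦ ⟪f, v⟫` in `Q.Dom`.
  refine ⟨Q.inclL ∘L (S.symm : Q.Dom →L[ℝ] Q.Dom) ∘L ContinuousLinearMap.adjoint Q.inclL,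
    fun f => isGenerator_iff.2
      ⟨S.symm (ContinuousLinearMap.adjoint Q.inclL f), rfl, fun v => ?_⟩, fun u w h => ?_⟩
  · have := hS f v
    simp only [ContinuousLinearMap.comp_apply, inclL_apply, neg_sub, inner_sub_left,
      real_inner_smul_left, ContinuousLinearEquiv.coe_coe]
    linarith
  · obtain ⟨x, rfl, hx⟩ := isGenerator_iff.1 h
    simp only [ContinuousLinearMap.comp_apply, inclL_apply, ContinuousLinearEquiv.coe_coe]
    congr 1
    rw [S.symm_apply_eq]
    refine ext_inner_right ℝ fun v => ?_
    rw [hc.continuousLinearEquivOfBilin_apply, hB, hx, ContinuousLinearMap.adjoint_inner_left,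
      inclL_apply, inner_sub_left, real_inner_smul_left, inner_neg_left]
    ring

lemma isResolvent_resolvent (hQ : Q.IsClosed) {α : ℝ} (hα : 0 < α) :
    Q.IsResolvent α (Q.resolvent α) :=
  Classical.epsilon_spec (exists_isResolvent hQ hα)

/-- By symmetry of the resolvent, a vector `v` orthogonal to the range has `G v = 0`; the resolvent
equation then makes `v` orthogonal to the dense domain of `Q`. -/
lemma dense_range_resolvent (hQ : Q.IsClosed) (hd : Q.IsDenselyDefined) {α : ℝ} (hα : 0 < α) :
    DenseRange (Q.resolvent α) := by
  have hG := isResolvent_resolvent hQ hα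
  have h : (LinearMap.range (Q.resolvent α : H →ₗ[ℝ] H)).topologicalClosure = ⊤ := by
    rw [Submodule.topologicalClosure_eq_top_iff, Submodule.eq_bot_iff]
    intro v hv
    rw [Submodule.mem_orthogonal] at hv
    have h0 : Q.resolvent α v = 0 := by
      rw [← inner_self_eq_zero (𝕜 := ℝ), ← hG.inner_comm]
      exact hv _ ⟨_, rfl⟩
    obtain ⟨x, hx, hxv⟩ := isGenerator_iff.1 (hG.1 v)
    have hx0 : x = 0 := Q.incl_injective (by rw [hx, h0, map_zero])
    refine eq_zero_of_inner_incl hd fun w => ?_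
    have := hxv w
    rw [hx0, h0] at this
    simpa using this.symm
  have := (Submodule.dense_iff_topologicalClosure_eq_top).2 h
  exact this

end Generator

/-! ### Closures of closable forms -/

section Closure

variable {H : Type*} [NormedAddCommGroup H] [InnerProductSpace ℝ H] [CompleteSpace H]

/-- The closure's form is the inner product of the completion minus that of `H`, so its `Q₁`-norm is
exactly the norm of the completion. -/
lemma closure_isClosed (Q : QForm H) (hQ : Q.IsClosable) : (Q.closure hQ).IsClosed := by
  let e : (Q.closure hQ).Dom →ₗ[ℝ] UniformSpace.Completion Q.Dom :=
    { toFun := fun x => (Q.closureEquiv hQ).symm x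
      map_add' := fun x y => map_add (Q.closureEquiv hQ).symm x y
      map_smul' := fun r x => map_smul (Q.closureEquiv hQ).symm r x }
  have he : ∀ x, ‖e x‖ = ‖x‖ := fun x => by
    rw [← sq_eq_sq₀ (norm_nonneg _) (norm_nonneg _), norm_sq_dom, ← real_inner_self_eq_norm_sq,
      ← real_inner_self_eq_norm_sq]
    exact (sub_add_cancel _ _).symm
  have hi : Isometry e := AddMonoidHomClass.isometry_of_norm e he
  exact (hi.isUniformInducing.completeSpace_congr (Q.closureEquiv hQ).symm.surjective).2
    inferInstance

lemma closure_isDenselyDefined (Q : QForm H) (hQ : Q.IsClosable) (hd : Q.IsDenselyDefined) :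
    (Q.closure hQ).IsDenselyDefined :=
  hd.mono fun u hu => ⟨((show Q.Dom from ⟨u, hu⟩ : Q.Dom) : UniformSpace.Completion Q.Dom), Q.extIncl_coe _⟩

end Closure

end QForm

/-! ### Exponentials of bounded dissipative operators -/

section ContractionExp

variable {H : Type*} [NormedAddCommGroup H] [InnerProductSpace ℝ H] {A B : H →L[ℝ] H}

lemma commute_exp_smul (h : Commute A B) (t : ℝ) : Commute (NormedSpace.exp (t • A)) B := by
  let _ : NormedAlgebra ℚ (H →L[ℝ] H) := NormedAlgebra.restrictScalars ℚ ℝ _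
  exact (h.smul_left t).exp_left

variable [CompleteSpace H]

lemma hasDerivAt_exp_smul_apply (A : H →L[ℝ] H) (u : H) (t : ℝ) :
    HasDerivAt (fun s : ℝ => NormedSpace.exp (s • A) u) (A (NormedSpace.exp (t • A) u)) t := by
  simpa using (hasDerivAt_exp_smul_const' A t).clm_apply (hasDerivAt_const t u)

lemma exp_add_smul (A : H →L[ℝ] H) (s t : ℝ) : NormedSpace.exp ((s + t) • A) =
    (NormedSpace.exp (s • A)).comp (NormedSpace.exp (t • A)) := by
  let _ : NormedAlgebra ℚ (H →L[ℝ] H) := NormedAlgebra.restrictScalars ℚ ℝ _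
  rw [add_smul]
  exact NormedSpace.exp_add_of_commute (((Commute.refl A).smul_left s).smul_right t)

/-- A bounded dissipative operator generates contractions. -/
lemma norm_exp_smul_apply_le (hA : ∀ u, inner ℝ (A u) u ≤ 0) {t : ℝ} (ht : 0 ≤ t) (u : H) :
    ‖NormedSpace.exp (t • A) u‖ ≤ ‖u‖ := by
  have hd : ∀ s : ℝ, HasDerivAt (fun s : ℝ => ‖NormedSpace.exp (s • A) u‖ ^ 2)
      (2 * inner ℝ (NormedSpace.exp (s • A) u) (A (NormedSpace.exp (s • A) u))) s := fun s =>
    (hasDerivAt_exp_smul_apply A u s).norm_sq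
  have hanti := antitone_of_deriv_nonpos (fun s => (hd s).differentiableAt) fun s => by
    rw [(hd s).deriv, real_inner_comm]
    linarith [hA (NormedSpace.exp (s • A) u)]
  have h := hanti ht
  simp only [zero_smul, NormedSpace.exp_zero, one_apply_eq_self] at h
  exact (sq_le_sq₀ (norm_nonneg _) (norm_nonneg _)).1 h

/-- Interpolate by `s ↦ e^{sA} e^{(t-s)B} u`: as `A` and `B` commute, its derivative is `e^{sA}
e^{(t-s)B} (A u - B u)`, of norm at most `‖A u - B u‖`. -/
lemma norm_exp_smul_sub_exp_smul_le (hA : ∀ u, inner ℝ (A u) u ≤ 0)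
    (hB : ∀ u, inner ℝ (B u) u ≤ 0) (h : Commute A B) {t : ℝ} (ht : 0 ≤ t) (u : H) :
    ‖NormedSpace.exp (t • A) u - NormedSpace.exp (t • B) u‖ ≤ ‖A u - B u‖ * t := by
  have hd : ∀ s : ℝ, HasDerivAt
      (fun s : ℝ => NormedSpace.exp (s • A) (NormedSpace.exp ((t - s) • B) u))
      (NormedSpace.exp (s • A) (NormedSpace.exp ((t - s) • B) (A u - B u))) s := fun s => by
    have h1 := hasDerivAt_exp_smul_const A s
    have h2 : HasDerivAt (fun s : ℝ => NormedSpace.exp ((t - s) • B) u)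
        (-(B (NormedSpace.exp ((t - s) • B) u))) s := by
      have h := (hasDerivAt_exp_smul_apply B u (t - s)).scomp s ((hasDerivAt_id s).const_sub t)
      rw [neg_one_smul] at h
      exact h
    refine (h1.clm_apply h2).congr_deriv ?_
    have h3 : NormedSpace.exp ((t - s) • B) (A u) = A (NormedSpace.exp ((t - s) • B) u) :=
      DFunLike.congr_fun (commute_exp_smul h.symm (t - s)).eq u
    have h4 : NormedSpace.exp ((t - s) • B) (B u) = B (NormedSpace.exp ((t - s) • B) u) :=
      DFunLike.congr_fun (commute_exp_smul (Commute.refl B) (t - s)).eq u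
    rw [map_sub, h3, h4, mul_apply_eq_comp, map_sub, map_neg, ← sub_eq_add_neg]
  have hb := norm_image_sub_le_of_norm_deriv_le_segment' (a := 0) (b := t) (C := ‖A u - B u‖)
    (fun s _ => (hd s).hasDerivWithinAt) (fun s hs =>
      (norm_exp_smul_apply_le hA hs.1 _).trans
        (norm_exp_smul_apply_le hB (sub_nonneg.2 hs.2.le) _)) t ⟨ht, le_rfl⟩
  simpa using hb

lemma norm_exp_smul_sub_exp_smul_le_mul (hA : ∀ u, inner ℝ (A u) u ≤ 0) {s t : ℝ} (hs : 0 ≤ s)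
    (hst : s ≤ t) (u : H) :
    ‖NormedSpace.exp (t • A) u - NormedSpace.exp (s • A) u‖ ≤ ‖A u‖ * (t - s) := by
  refine norm_image_sub_le_of_norm_deriv_le_segment' (a := s) (b := t)
    (f := fun s : ℝ => NormedSpace.exp (s • A) u)
    (fun x _ => (hasDerivAt_exp_smul_apply A u x).hasDerivWithinAt) (fun x hx => ?_) t
    ⟨hst, le_rfl⟩
  have h : NormedSpace.exp (x • A) (A u) = A (NormedSpace.exp (x • A) u) :=
    DFunLike.congr_fun (commute_exp_smul (Commute.refl A) x).eq u
  rw [← h]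
  exact norm_exp_smul_apply_le hA (hs.trans hx.1) _

/-- A first-order Taylor bound free of `A (A u)`, which need not stay bounded along Yosida
approximations. The derivative of the left side is `(e^{xA} - 1) A u`; split `A u` into `A u - z`
and a `z` for which `A z` is controlled. -/
lemma norm_exp_smul_sub_sub_smul_le (hA : ∀ u, inner ℝ (A u) u ≤ 0) {t : ℝ} (ht : 0 ≤ t)
    (u z : H) :
    ‖NormedSpace.exp (t • A) u - u - t • A u‖ ≤ (2 * ‖A u - z‖ + ‖A z‖ * t) * t := by
  have hd : ∀ x : ℝ, HasDerivAt (fun s : ℝ => NormedSpace.exp (s • A) u - s • A u)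
      (NormedSpace.exp (x • A) (A u) - A u) x := fun x => by
    have h : NormedSpace.exp (x • A) (A u) = A (NormedSpace.exp (x • A) u) :=
      DFunLike.congr_fun (commute_exp_smul (Commute.refl A) x).eq u
    rw [h]
    have h' := (hasDerivAt_exp_smul_apply A u x).sub ((hasDerivAt_id x).smul_const (A u))
    rw [one_smul] at h'
    exact h'
  have hb := norm_image_sub_le_of_norm_deriv_le_segment' (a := 0) (b := t)
    (C := 2 * ‖A u - z‖ + ‖A z‖ * t)
    (fun s _ => (hd s).hasDerivWithinAt) (fun x hx => ?_) t ⟨ht, le_rfl⟩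
  · simp only [zero_smul, NormedSpace.exp_zero, one_apply_eq_self, sub_zero] at hb
    rwa [sub_right_comm]
  · have h1 : NormedSpace.exp (x • A) (A u) - A u =
        NormedSpace.exp (x • A) (A u - z) - (A u - z) + (NormedSpace.exp (x • A) z - z) := by
      rw [map_sub]; abel
    have h2 := norm_exp_smul_apply_le hA hx.1 (A u - z)
    have h3 := norm_exp_smul_sub_exp_smul_le_mul hA le_rfl hx.1 z
    simp only [zero_smul, NormedSpace.exp_zero, one_apply_eq_self, sub_zero] at h3
    have h4 := norm_sub_le (NormedSpace.exp (x • A) (A u - z)) (A u - z)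
    have h5 : ‖A z‖ * x ≤ ‖A z‖ * t := mul_le_mul_of_nonneg_left hx.2.le (norm_nonneg _)
    rw [h1]
    refine (norm_add_le _ _).trans ?_
    linarith

end ContractionExp

namespace QForm

/-! ### The semigroup as limit of Yosida approximations -/

section Yosida

variable {H : Type*} [NormedAddCommGroup H] [InnerProductSpace ℝ H]

/-- The Yosida approximation `α (α G_α - 1)` of the generator. -/
noncomputable def yosida (Q : QForm H) (α : ℝ) : H →L[ℝ] H :=
  α • (α • Q.resolvent α - ContinuousLinearMap.id ℝ H)

lemma yosida_apply (Q : QForm H) (α : ℝ) (u : H) :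
    Q.yosida α u = α • (α • Q.resolvent α u - u) := rfl

variable [CompleteSpace H] {Q : QForm H}

lemma yosida_inner_nonpos (hQ : Q.IsClosed) {α : ℝ} (hα : 0 < α) (u : H) :
    inner ℝ (Q.yosida α u) u ≤ 0 := by
  have h1 := (isResolvent_resolvent hQ hα).mul_norm_le u
  have h2 := real_inner_le_norm (Q.resolvent α u) u
  rw [yosida_apply, real_inner_smul_left, inner_sub_left, real_inner_smul_left,
    real_inner_self_eq_norm_sq]
  have h3 := norm_nonneg u
  refine mul_nonpos_of_nonneg_of_nonpos hα.le ?_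
  nlinarith

lemma commute_yosida (hQ : Q.IsClosed) {α β : ℝ} (hα : 0 < α) (hβ : 0 < β) :
    Commute (Q.yosida α) (Q.yosida β) := by
  have h := (isResolvent_resolvent hQ hα).comm (isResolvent_resolvent hQ hβ)
  have h1 : Commute (α • Q.resolvent α - 1) (β • Q.resolvent β - 1) :=
    (((h.smul_left α).smul_right β).sub_right (Commute.one_right _)).sub_left
      (Commute.one_left _)
  exact (h1.smul_left α).smul_right β

lemma yosida_apply_of_isGenerator (hQ : Q.IsClosed) {α : ℝ} (hα : 0 < α) {u w : H}
    (h : Q.IsGenerator u w) : Q.yosida α u = α • Q.resolvent α w := by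
  have h1 := (isResolvent_resolvent hQ hα).2 _ _ h
  rw [map_sub, map_smul, sub_eq_iff_eq_add] at h1
  rw [yosida_apply, h1, add_sub_cancel_left]

lemma norm_smul_resolvent_le (hQ : Q.IsClosed) {α : ℝ} (hα : 0 < α) (u : H) :
    ‖α • Q.resolvent α u‖ ≤ ‖u‖ := by
  rw [norm_smul, Real.norm_of_nonneg hα.le]
  exact (isResolvent_resolvent hQ hα).mul_norm_le u

lemma exists_isGenerator_norm_sub_lt (hQ : Q.IsClosed) (hd : Q.IsDenselyDefined) (u : H) {ε : ℝ}
    (hε : 0 < ε) : ∃ z w, Q.IsGenerator z w ∧ ‖u - z‖ < ε := by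
  obtain ⟨f, hf⟩ := (dense_range_resolvent hQ hd one_pos).exists_dist_lt u hε
  exact ⟨_, _, (isResolvent_resolvent hQ one_pos).1 f, by rwa [← dist_eq_norm]⟩

/-- For `z` in `dom L`, `α G_α z - z = G_α L z` is `O(1/α)`; density of `dom L` and `‖α G_α‖ ≤ 1`
extend this to all of `H`. -/
lemma tendsto_smul_resolvent (hQ : Q.IsClosed) (hd : Q.IsDenselyDefined) (u : H) :
    Tendsto (fun α : ℝ => α • Q.resolvent α u) atTop (𝓝 u) := by
  rw [Metric.tendsto_nhds]
  intro ε hε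
  obtain ⟨z, w, hz, hu⟩ := exists_isGenerator_norm_sub_lt hQ hd u (ε := ε / 3) (by positivity)
  filter_upwards [eventually_gt_atTop (max 0 (3 * ‖w‖ / ε))] with α hα
  have hα0 : 0 < α := (le_max_left _ _).trans_lt hα
  have hα1 : 3 * ‖w‖ / ε < α := (le_max_right _ _).trans_lt hα
  have h1 := (isResolvent_resolvent hQ hα0).2 _ _ hz
  rw [map_sub, map_smul, sub_eq_iff_eq_add] at h1
  have h2 : ‖Q.resolvent α w‖ ≤ ε / 3 := by
    have := (isResolvent_resolvent hQ hα0).mul_norm_le w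
    rw [div_lt_iff₀ hε] at hα1
    refine le_of_mul_le_mul_left ?_ hα0
    linarith
  have h3 := norm_smul_resolvent_le hQ hα0 (u - z)
  have h4 : α • Q.resolvent α u - u =
      α • Q.resolvent α (u - z) - (u - z) + Q.resolvent α w := by
    rw [map_sub, smul_sub, h1]; abel
  rw [dist_eq_norm, h4]
  have h5 := norm_add_le (α • Q.resolvent α (u - z) - (u - z)) (Q.resolvent α w)
  have h6 := norm_sub_le (α • Q.resolvent α (u - z)) (u - z)
  linarith

/-- Yosida parameters run through `n + 1`, which is positive from `n = 0` on. -/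
lemma tendsto_natCast_add_one : Tendsto (fun n : ℕ => (n : ℝ) + 1) atTop atTop :=
  tendsto_atTop_add_const_right _ _ tendsto_natCast_atTop_atTop

lemma tendsto_yosida (hQ : Q.IsClosed) (hd : Q.IsDenselyDefined) {u w : H}
    (h : Q.IsGenerator u w) :
    Tendsto (fun n : ℕ => Q.yosida (n + 1) u) atTop (𝓝 w) := by
  refine ((tendsto_smul_resolvent hQ hd w).comp tendsto_natCast_add_one).congr fun n => ?_
  exact (yosida_apply_of_isGenerator hQ (by positivity) h).symm

lemma norm_yosida_le (hQ : Q.IsClosed) {α : ℝ} (hα : 0 < α) {u w : H}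
    (h : Q.IsGenerator u w) : ‖Q.yosida α u‖ ≤ ‖w‖ := by
  rw [yosida_apply_of_isGenerator hQ hα h]
  exact norm_smul_resolvent_le hQ hα w

/-- For `z` in `dom L` the distance of two approximating semigroups is at most `t ‖A_m z - A_n z‖`,
and `A_n z` converges; contractivity and density give the other vectors. -/
lemma exists_tendsto_exp_yosida (hQ : Q.IsClosed) (hd : Q.IsDenselyDefined) (t : ℝ≥0) :
    ∃ T : H →L[ℝ] H, ∀ u,
      Tendsto (fun n : ℕ => NormedSpace.exp ((t : ℝ) • Q.yosida (n + 1)) u) atTop (𝓝 (T u)) := by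
  have hc : ∀ u, CauchySeq fun n : ℕ => NormedSpace.exp ((t : ℝ) • Q.yosida (n + 1)) u := by
    intro u
    rw [Metric.cauchySeq_iff]
    intro ε hε
    obtain ⟨z, w, hz, hu⟩ := exists_isGenerator_norm_sub_lt hQ hd u (ε := ε / 4) (by positivity)
    have hc := (tendsto_yosida hQ hd hz).cauchySeq
    rw [Metric.cauchySeq_iff] at hc
    -- `t + 1` in place of `t` keeps the quotient meaningful at `t = 0`.
    obtain ⟨N, hN⟩ := hc (ε / (2 * (t + 1))) (by positivity)
    refine ⟨N, fun m hm n hn => ?_⟩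
    have h1 := norm_exp_smul_sub_exp_smul_le (yosida_inner_nonpos hQ (α := m + 1) (by positivity))
      (yosida_inner_nonpos hQ (α := n + 1) (by positivity))
      (commute_yosida hQ (by positivity) (by positivity)) t.2 z
    have h2 := hN m hm n hn
    rw [dist_eq_norm, lt_div_iff₀ (by positivity)] at h2
    have h3 := norm_exp_smul_apply_le (yosida_inner_nonpos hQ (α := m + 1) (by positivity))
      t.2 (u - z)
    have h4 := norm_exp_smul_apply_le (yosida_inner_nonpos hQ (α := n + 1) (by positivity))
      t.2 (u - z)
    simp only [NNReal.val_eq_coe] at h1 h3 h4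
    have h5 : NormedSpace.exp ((t : ℝ) • Q.yosida (m + 1)) u -
        NormedSpace.exp ((t : ℝ) • Q.yosida (n + 1)) u =
        (NormedSpace.exp ((t : ℝ) • Q.yosida (m + 1)) (u - z) -
          NormedSpace.exp ((t : ℝ) • Q.yosida (n + 1)) (u - z)) +
        (NormedSpace.exp ((t : ℝ) • Q.yosida (m + 1)) z -
          NormedSpace.exp ((t : ℝ) • Q.yosida (n + 1)) z) := by
      simp only [map_sub]; abel
    rw [dist_eq_norm, h5]
    refine (norm_add_le _ _).trans_lt ?_
    have h6 := norm_sub_le (NormedSpace.exp ((t : ℝ) • Q.yosida (m + 1)) (u - z))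
          (NormedSpace.exp ((t : ℝ) • Q.yosida (n + 1)) (u - z))
    have h7 := norm_nonneg (Q.yosida (m + 1) z - Q.yosida (n + 1) z)
    nlinarith
  choose f hf using fun u => cauchySeq_tendsto_of_complete (hc u)
  exact ⟨continuousLinearMapOfTendsto _ (tendsto_pi_nhds.2 hf), hf⟩

/-- A densely defined closed form has a semigroup, the limit of the semigroups of the Yosida
approximations. -/
lemma exists_isSemigroup_tendsto (hQ : Q.IsClosed) (hd : Q.IsDenselyDefined) :
    ∃ T : ℝ≥0 → H →L[ℝ] H, Q.IsSemigroup T ∧ ∀ (t : ℝ≥0) u,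
      Tendsto (fun n : ℕ => NormedSpace.exp ((t : ℝ) • Q.yosida (n + 1)) u) atTop
        (𝓝 (T t u)) := by
  choose T hT using exists_tendsto_exp_yosida hQ hd
  have hdiss : ∀ (n : ℕ) u, inner ℝ (Q.yosida (n + 1) u) u ≤ 0 := fun n =>
    yosida_inner_nonpos hQ (by positivity)
  have hnorm : ∀ t u, ‖T t u‖ ≤ ‖u‖ := fun t u =>
    le_of_tendsto (hT t u).norm (Eventually.of_forall fun n =>
      norm_exp_smul_apply_le (hdiss n) t.2 u)
  have hadd : ∀ s t, T (s + t) = (T s).comp (T t) := fun s t => by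
    ext u
    refine tendsto_nhds_unique (hT (s + t) u) ?_
    have h1 := hT s (T t u)
    have h2 : Tendsto (fun n : ℕ => NormedSpace.exp ((s : ℝ) • Q.yosida (n + 1))
        (NormedSpace.exp ((t : ℝ) • Q.yosida (n + 1)) u - T t u)) atTop (𝓝 0) := by
      refine squeeze_zero_norm (fun n => norm_exp_smul_apply_le (hdiss n) s.2 _) ?_
      simpa using ((hT t u).sub_const (T t u)).norm
    have h3 := h2.add h1
    rw [zero_add] at h3
    refine h3.congr fun n => ?_
    rw [← map_add, sub_add_cancel, NNReal.coe_add, exp_add_smul]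
    rfl
  have hlip : ∀ {u w}, Q.IsGenerator u w → ∀ {s t : ℝ≥0}, s ≤ t →
      ‖T t u - T s u‖ ≤ ‖w‖ * (t - s) := fun {u w} h {s t} hst =>
    le_of_tendsto ((hT t u).sub (hT s u)).norm (Eventually.of_forall fun n =>
      (norm_exp_smul_sub_exp_smul_le_mul (hdiss n) s.2 (NNReal.coe_le_coe.2 hst) u).trans
        (mul_le_mul_of_nonneg_right (norm_yosida_le hQ (by positivity) h)
          (sub_nonneg.2 (NNReal.coe_le_coe.2 hst))))
  have hgen : ∀ {u w}, Q.IsGenerator u w →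
      Tendsto (fun t : ℝ≥0 => (t : ℝ)⁻¹ • (T t u - u)) (𝓝[>] 0) (𝓝 w) := by
    intro u w h
    -- The limit of the Taylor bound: `A_n u` tends to `w`, and `‖A_n z‖ ≤ ‖z'‖` for all `n`.
    -- Choosing `z` in `dom L` close to `w` makes the error `o(t)`.
    have hest : ∀ (t : ℝ≥0) {z z'}, Q.IsGenerator z z' →
        ‖T t u - u - (t : ℝ) • w‖ ≤ (2 * ‖w - z‖ + ‖z'‖ * (t : ℝ)) * (t : ℝ) := by
      intro t z z' hz
      have hy := tendsto_yosida hQ hd h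
      refine le_of_tendsto_of_tendsto (((hT t u).sub_const u).sub (hy.const_smul (t : ℝ))).norm
        ((((hy.sub_const z).norm.const_mul 2).add_const (‖z'‖ * t)).mul_const (t : ℝ))
        (Eventually.of_forall fun n => ?_)
      refine (norm_exp_smul_sub_sub_smul_le (hdiss n) t.2 u z).trans ?_
      have := norm_yosida_le hQ (α := n + 1) (by positivity) hz
      simp only [NNReal.val_eq_coe]
      gcongr
    rw [Metric.tendsto_nhds]
    intro ε hε
    obtain ⟨z, z', hz, hwz⟩ := exists_isGenerator_norm_sub_lt hQ hd w (ε := ε / 4)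
      (by positivity)
    have hlim : Tendsto (fun t : ℝ≥0 => ‖z'‖ * (t : ℝ)) (𝓝[>] 0) (𝓝 0) := by
      have : Continuous fun t : ℝ≥0 => ‖z'‖ * (t : ℝ) := by fun_prop
      simpa using (this.tendsto 0).mono_left nhdsWithin_le_nhds
    filter_upwards [self_mem_nhdsWithin, hlim.eventually_lt_const (half_pos hε)] with t ht ht'
    have ht0 : (0 : ℝ) < t := NNReal.coe_pos.2 ht
    have h1 : (t : ℝ)⁻¹ • (T t u - u) - w = (t : ℝ)⁻¹ • (T t u - u - (t : ℝ) • w) := by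
      rw [smul_sub _ (T t u - u), smul_smul, inv_mul_cancel₀ ht0.ne', one_smul]
    rw [dist_eq_norm, h1, norm_smul, norm_inv, Real.norm_of_nonneg ht0.le,
      inv_mul_lt_iff₀ ht0]
    refine (hest t hz).trans_lt ?_
    rw [mul_comm]
    gcongr
    linarith
  refine ⟨T, ⟨?_, hadd, ?_, ?_, ?_⟩, hT⟩
  · ext u
    refine tendsto_nhds_unique (hT 0 u) ?_
    simp
  · exact fun t => ContinuousLinearMap.opNorm_le_bound _ zero_le_one fun u => by
      simpa using hnorm t u
  · intro u
    -- Orbits of vectors `z` in `dom L` are Lipschitz with constant `‖L z‖`, and they approximate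
    -- the orbit of `u` uniformly in `t`.
    refine continuous_of_uniform_approx_of_continuous fun V hV => ?_
    obtain ⟨ε, hε, hεV⟩ := Metric.mem_uniformity_dist.1 hV
    obtain ⟨z, w, hz, hu⟩ := exists_isGenerator_norm_sub_lt hQ hd u hε
    refine ⟨fun t => T t z, ?_, fun t => hεV ?_⟩
    · refine (LipschitzWith.of_dist_le_mul (K := ‖w‖₊) fun s t => ?_).continuous
      rw [dist_eq_norm, NNReal.dist_eq, coe_nnnorm]
      rcases le_total s t with hst | hst
      · rw [norm_sub_rev, abs_sub_comm, abs_of_nonneg (sub_nonneg.2 (NNReal.coe_le_coe.2 hst))]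
        exact hlip hz hst
      · rw [abs_of_nonneg (sub_nonneg.2 (NNReal.coe_le_coe.2 hst))]
        exact hlip hz hst
    · rw [dist_eq_norm, ← map_sub]
      exact (hnorm t _).trans_lt hu
  -- Maximality of `L`: solve `v - L v = u - w`. The difference quotients at `u - v` then tend to `u
  -- - v` itself, while contractivity makes their inner products with `u - v` nonpositive; so `u =
  -- v`.
  · refine fun u w => ⟨hgen, fun h => ?_⟩
    have hv := (isResolvent_resolvent hQ one_pos).1 (u - w)
    set v := Q.resolvent 1 (u - w) with hvdef
    rw [one_smul] at hv
    have hx := h.sub (hgen hv)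
    rw [sub_sub_eq_add_sub, add_sub_cancel] at hx
    have hle : inner ℝ (u - v) (u - v) ≤ 0 := by
      refine le_of_tendsto (hx.inner tendsto_const_nhds) (Eventually.of_forall fun t => ?_)
      have h1 : (t : ℝ)⁻¹ • (T t u - u) - (t : ℝ)⁻¹ • (T t v - v) =
          (t : ℝ)⁻¹ • (T t (u - v) - (u - v)) := by
        rw [← smul_sub, map_sub]; congr 1; abel
      rw [h1, real_inner_smul_left]
      refine mul_nonpos_of_nonneg_of_nonpos (inv_nonneg.2 t.2) ?_
      rw [inner_sub_left, real_inner_self_eq_norm_sq]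
      have h2 := real_inner_le_norm (T t (u - v)) (u - v)
      have h3 := hnorm t (u - v)
      nlinarith [norm_nonneg (u - v)]
    have h0 : u = v := sub_eq_zero.1 (real_inner_self_nonpos.1 hle)
    rw [← h0] at hv
    simpa using hv

end Yosida

/-! ### Uniqueness of the semigroup -/

section Uniqueness

variable {H : Type*} [NormedAddCommGroup H] [InnerProductSpace ℝ H] {Q : QForm H}
  {T T' : ℝ≥0 → H →L[ℝ] H}

lemma IsSemigroup.isGenerator_apply (hT : Q.IsSemigroup T) {u w : H} (h : Q.IsGenerator u w)
    (t : ℝ≥0) : Q.IsGenerator (T t u) (T t w) := by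
  rw [hT.generator] at h ⊢
  refine (((T t).continuous.tendsto w).comp h).congr fun s => ?_
  have h1 : T t (T s u) = T s (T t u) := by
    rw [← ContinuousLinearMap.comp_apply, ← hT.add, add_comm, hT.add,
      ContinuousLinearMap.comp_apply]
  simp [h1]

/-- Only the right derivative comes directly from the generator, through `T_y = T_{y-x} T_x`; it is
all that the comparison argument for uniqueness requires. -/
lemma IsSemigroup.hasDerivWithinAt (hT : Q.IsSemigroup T) {u w : H} (h : Q.IsGenerator u w)
    {x : ℝ} (hx : 0 ≤ x) :
    HasDerivWithinAt (fun s : ℝ => T s.toNNReal u) (T x.toNNReal w) (Set.Ici x) x := by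
  rw [← hasDerivWithinAt_Ioi_iff_Ici, hasDerivWithinAt_iff_tendsto_slope' Set.self_notMem_Ioi]
  have h1 := (hT.generator _ _).1 (hT.isGenerator_apply h x.toNNReal)
  have h2 : Tendsto (fun y : ℝ => (y - x).toNNReal) (𝓝[>] x) (𝓝[>] 0) := by
    refine tendsto_nhdsWithin_iff.2 ⟨?_, ?_⟩
    · have : Continuous fun y : ℝ => (y - x).toNNReal := by fun_prop
      simpa using (this.tendsto x).mono_left nhdsWithin_le_nhds
    · filter_upwards [self_mem_nhdsWithin] with y hy
      exact Real.toNNReal_pos.2 (sub_pos.2 hy)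
  refine (h1.comp h2).congr' ?_
  filter_upwards [self_mem_nhdsWithin] with y hy
  have hxy : 0 ≤ y - x := (sub_pos.2 hy).le
  have h3 : y.toNNReal = (y - x).toNNReal + x.toNNReal := by
    rw [← Real.toNNReal_add hxy hx, sub_add_cancel]
  rw [slope_def_module, h3, hT.add]
  simp [hxy]

variable [CompleteSpace H]

/-- The semigroup of a densely defined closed form is unique. -/
lemma IsSemigroup.unique (hQ : Q.IsClosed) (hd : Q.IsDenselyDefined) (hT : Q.IsSemigroup T)
    (hT' : Q.IsSemigroup T') : T = T' := by
  have key : ∀ u w, Q.IsGenerator u w → ∀ t, T t u = T' t u := by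
    intro u w h t
    have hcont : Continuous fun s : ℝ => ‖T s.toNNReal u - T' s.toNNReal u‖ ^ 2 :=
      ((((hT.continuous u).comp continuous_real_toNNReal).sub
        ((hT'.continuous u).comp continuous_real_toNNReal)).norm).pow 2
    -- With `x_s = T_s u - T'_s u`, the right derivative of `‖x_s‖²` is `2⟪x_s, L x_s⟫ ≤ 0`, and
    -- `x_0 = 0`.
    have := image_le_of_deriv_right_le_deriv_boundary (a := 0) (b := t) (B := fun _ => (0 : ℝ))
      (B' := fun _ => 0) hcont.continuousOn
      (fun x hx => ((hT.hasDerivWithinAt h hx.1).sub (hT'.hasDerivWithinAt h hx.1)).norm_sq)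
      (by simp [hT.zero, hT'.zero]) continuousOn_const
      (fun x _ => hasDerivWithinAt_const _ _ _) (fun x _ => by
        have := ((hT.isGenerator_apply h x.toNNReal).sub
          (hT'.isGenerator_apply h x.toNNReal)).inner_nonpos
        rw [real_inner_comm] at this
        simp only [Pi.sub_apply]
        linarith) (x := t) ⟨t.2, le_rfl⟩
    simp only [Real.toNNReal_coe] at this
    exact sub_eq_zero.1 (norm_eq_zero.1 (pow_eq_zero_iff two_ne_zero |>.1
      (le_antisymm this (sq_nonneg _))))
  ext t u
  have h : (fun u => T t u) = fun u => T' t u :=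
    (dense_range_resolvent hQ hd one_pos).equalizer (T t).continuous (T' t).continuous
      (funext fun f => key _ _ ((isResolvent_resolvent hQ one_pos).1 f) t)
  exact congrFun h u

lemma isSemigroup_semigroup (hQ : Q.IsClosed) (hd : Q.IsDenselyDefined) :
    Q.IsSemigroup Q.semigroup :=
  Classical.epsilon_spec ((exists_isSemigroup_tendsto hQ hd).imp fun _ h => h.1)

lemma tendsto_semigroup (hQ : Q.IsClosed) (hd : Q.IsDenselyDefined) (t : ℝ≥0) (u : H) :
    Tendsto (fun n : ℕ => NormedSpace.exp ((t : ℝ) • Q.yosida (n + 1)) u) atTop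
      (𝓝 (Q.semigroup t u)) := by
  obtain ⟨T, hT, h⟩ := exists_isSemigroup_tendsto hQ hd
  rw [(isSemigroup_semigroup hQ hd).unique hQ hd hT]
  exact h t u

end Uniqueness

end QForm

/-! ### Measurable fields and completeness of direct integrals -/

namespace MeasurableField

variable {Z : Type*} [MeasurableSpace Z] {ν : Measure Z} {E : Z → Type*}
  [∀ ζ, NormedAddCommGroup (E ζ)] [∀ ζ, InnerProductSpace ℝ (E ζ)]

/-- Axiom (b) reduces this to almost everywhere limits of real `ν`-measurable functions. -/
lemma mem_fields_of_ae_tendsto (M : MeasurableField ν E) {v : ℕ → ∀ ζ, E ζ} {w : ∀ ζ, E ζ}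
    (hv : ∀ n, v n ∈ M.fields)
    (h : ∀ᵐ ζ ∂ν, Tendsto (fun n => v n ζ) atTop (𝓝 (w ζ))) : w ∈ M.fields := by
  refine M.mem_of_aemeasurable_inner w fun u hu => ?_
  refine aemeasurable_of_tendsto_metrizable_ae atTop
    (fun n => M.aemeasurable_inner hu (hv n)) ?_
  filter_upwards [h] with ζ hζ
  exact tendsto_const_nhds.inner hζ

lemma val_mem (M : MeasurableField ν E) (u : M.SqInt) : M.val u ∈ M.fields := u.2.1

lemma integrable_norm_sq (M : MeasurableField ν E) (u : M.SqInt) :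
    Integrable (fun ζ => ‖M.val u ζ‖ ^ 2) ν := u.2.2

lemma val_injective (M : MeasurableField ν E) : Function.Injective M.val :=
  Subtype.val_injective

lemma lintegral_norm_sq (M : MeasurableField ν E) (u : M.SqInt) :
    ∫⁻ ζ, ENNReal.ofReal (‖M.val u ζ‖ ^ 2) ∂ν = ENNReal.ofReal (‖u‖ ^ 2) := by
  rw [norm_sq_sqInt, ofReal_integral_eq_lintegral_ofReal (M.integrable_norm_sq u)
    (ae_of_all _ fun ζ => sq_nonneg _)]

lemma aemeasurable_ofReal_norm_sq (M : MeasurableField ν E) {u : ∀ ζ, E ζ} (hu : u ∈ M.fields) :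
    AEMeasurable (fun ζ => ENNReal.ofReal (‖u ζ‖ ^ 2)) ν :=
  ((M.aemeasurable_norm u hu).pow_const 2).ennreal_ofReal

lemma exists_val_eq_of_lintegral_le (M : MeasurableField ν E) {w : ∀ ζ, E ζ} (hw : w ∈ M.fields)
    {C : ℝ} (hC : 0 ≤ C)
    (h : ∫⁻ ζ, ENNReal.ofReal (‖w ζ‖ ^ 2) ∂ν ≤ ENNReal.ofReal (C ^ 2)) :
    ∃ v : M.SqInt, M.val v = w ∧ ‖v‖ ≤ C := by
  have hi : Integrable (fun ζ => ‖w ζ‖ ^ 2) ν := by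
    refine ⟨((M.aemeasurable_norm w hw).pow_const 2).aestronglyMeasurable, ?_⟩
    rw [hasFiniteIntegral_iff_ofReal (ae_of_all _ fun ζ => sq_nonneg _)]
    exact h.trans_lt ENNReal.ofReal_lt_top
  let v : M.SqInt := ⟨w, hw, hi⟩
  refine ⟨v, rfl, ?_⟩
  have h1 : ENNReal.ofReal (‖v‖ ^ 2) ≤ ENNReal.ofReal (C ^ 2) := by
    rw [← M.lintegral_norm_sq v]
    exact h
  rw [ENNReal.ofReal_le_ofReal_iff (sq_nonneg _)] at h1
  exact (sq_le_sq₀ (norm_nonneg _) hC).1 h1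

lemma exists_val_eq (M : MeasurableField ν E) {w : ∀ ζ, E ζ} (hw : w ∈ M.fields) {g : Z → ℝ}
    (hg : Integrable g ν) (h : ∀ᵐ ζ ∂ν, ‖w ζ‖ ^ 2 ≤ g ζ) : ∃ v : M.SqInt, M.val v = w :=
  ⟨⟨w, hw, hg.mono' ((M.aemeasurable_norm w hw).pow_const 2).aestronglyMeasurable (by
    filter_upwards [h] with ζ hζ
    rwa [Real.norm_of_nonneg (sq_nonneg _)])⟩, rfl⟩

/-- The weights `4 ^ n` leave `∑ 4 ^ n ‖u n - u (n + 1)‖²` summable after integration, hence finite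
almost everywhere; fibrewise increments are then `O(2 ^ (-n))`. -/
lemma ae_cauchySeq (M : MeasurableField ν E) {u : ℕ → M.SqInt}
    (hu : ∀ n, ‖u n - u (n + 1)‖ ≤ (1 / 4) ^ n) :
    ∀ᵐ ζ ∂ν, CauchySeq fun n => M.val (u n) ζ := by
  have hm : ∀ n, AEMeasurable
      (fun ζ => ENNReal.ofReal (4 ^ n) * ENNReal.ofReal (‖M.val (u n - u (n + 1)) ζ‖ ^ 2)) ν :=
    fun n => (M.aemeasurable_ofReal_norm_sq (M.val_mem (u n - u (n + 1)))).const_mul _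
  have hlt : ∫⁻ ζ, ∑' n, ENNReal.ofReal (4 ^ n) *
      ENNReal.ofReal (‖M.val (u n - u (n + 1)) ζ‖ ^ 2) ∂ν < ⊤ := by
    rw [lintegral_tsum hm]
    have hle : ∀ n, ∫⁻ ζ, ENNReal.ofReal (4 ^ n) *
        ENNReal.ofReal (‖M.val (u n - u (n + 1)) ζ‖ ^ 2) ∂ν ≤ ENNReal.ofReal ((1 / 4) ^ n) := by
      intro n
      rw [lintegral_const_mul'' _ (M.aemeasurable_ofReal_norm_sq (M.val_mem (u n - u (n + 1)))),
        lintegral_norm_sq, ← ENNReal.ofReal_mul (by positivity)]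
      refine ENNReal.ofReal_le_ofReal ?_
      calc (4 : ℝ) ^ n * ‖u n - u (n + 1)‖ ^ 2 ≤ 4 ^ n * ((1 / 4) ^ n) ^ 2 := by
            gcongr
            exact hu n
        _ = (1 / 4) ^ n := by
          rw [sq, ← mul_assoc, ← mul_pow]
          norm_num
    refine (ENNReal.tsum_le_tsum hle).trans_lt ?_
    have hs : Summable fun n : ℕ => ((1 : ℝ) / 4) ^ n :=
      summable_geometric_of_lt_one (by norm_num) (by norm_num)
    rw [← ENNReal.ofReal_tsum_of_nonneg (fun n => by positivity) hs]
    exact ENNReal.ofReal_lt_top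
  filter_upwards [ae_lt_top' (AEMeasurable.tsum hm) hlt.ne] with ζ hζ
  set S := ∑' n, ENNReal.ofReal (4 ^ n) * ENNReal.ofReal (‖M.val (u n - u (n + 1)) ζ‖ ^ 2)
  refine cauchySeq_of_le_geometric (1 / 2) (1 + S.toReal) (by norm_num) fun n => ?_
  have h1 : ENNReal.ofReal (4 ^ n) * ENNReal.ofReal (‖M.val (u n - u (n + 1)) ζ‖ ^ 2) ≤ S :=
    ENNReal.le_tsum n
  rw [← ENNReal.ofReal_mul (by positivity), ENNReal.ofReal_le_iff_le_toReal hζ.ne] at h1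
  rw [dist_eq_norm, ← Pi.sub_apply, ← map_sub]
  set d := ‖M.val (u n - u (n + 1)) ζ‖
  have h2 : (4 : ℝ) ^ n * d ^ 2 = (2 ^ n * d) ^ 2 := by
    rw [mul_pow, ← pow_mul, mul_comm n, pow_mul]
    norm_num
  -- `y ≤ 1 + y²` avoids a square root.
  have h3 : 2 ^ n * d ≤ 1 + S.toReal := by nlinarith [sq_nonneg (2 ^ n * d - 1)]
  calc d = (2 ^ n * d) * (1 / 2) ^ n := by
        rw [mul_right_comm, ← mul_pow]
        norm_num
    _ ≤ _ := by gcongr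

/-- The Riesz-Fischer theorem for measurable fields of Hilbert spaces. -/
instance (M : MeasurableField ν E) [∀ ζ, CompleteSpace (E ζ)] : CompleteSpace M.SqInt := by
  refine Metric.complete_of_convergent_controlled_sequences (fun n => (1 / 4) ^ n)
    (fun n => by positivity) fun u hu => ?_
  simp only [dist_eq_norm] at hu
  have hc := M.ae_cauchySeq (u := u) fun n => (hu n n (n + 1) le_rfl n.le_succ).le
  have hex : ∀ ζ, ∃ w : E ζ, CauchySeq (fun n => M.val (u n) ζ) →
      Tendsto (fun n => M.val (u n) ζ) atTop (𝓝 w) := fun ζ => by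
    by_cases h : CauchySeq fun n => M.val (u n) ζ
    · exact (cauchySeq_tendsto_of_complete h).imp fun _ h _ => h
    · exact ⟨0, fun h' => absurd h' h⟩
  choose w hw using hex
  have hlim : ∀ᵐ ζ ∂ν, Tendsto (fun n => M.val (u n) ζ) atTop (𝓝 (w ζ)) := by
    filter_upwards [hc] with ζ hζ using hw ζ hζ
  have hwm : w ∈ M.fields := M.mem_fields_of_ae_tendsto (fun n => M.val_mem (u n)) hlim
  have hfatou : ∀ n, ∫⁻ ζ, ENNReal.ofReal (‖(M.val (u n) - w) ζ‖ ^ 2) ∂ν ≤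
      ENNReal.ofReal (((1 / 4) ^ n) ^ 2) := by
    intro n
    have h1 : ∀ᵐ ζ ∂ν, ENNReal.ofReal (‖(M.val (u n) - w) ζ‖ ^ 2) =
        liminf (fun m => ENNReal.ofReal (‖M.val (u n - u m) ζ‖ ^ 2)) atTop := by
      filter_upwards [hlim] with ζ hζ
      refine (Tendsto.liminf_eq ?_).symm
      refine ENNReal.tendsto_ofReal ((Tendsto.norm ?_).pow 2)
      simpa only [map_sub, Pi.sub_apply] using hζ.const_sub (M.val (u n) ζ)
    rw [lintegral_congr_ae h1]
    refine (lintegral_liminf_le' fun m =>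
      M.aemeasurable_ofReal_norm_sq (M.val_mem (u n - u m))).trans ?_
    refine liminf_le_of_le (by isBoundedDefault) fun b hb => ?_
    obtain ⟨m, hm, hmn⟩ := (hb.and (eventually_ge_atTop n)).exists
    refine hm.trans ?_
    rw [lintegral_norm_sq]
    refine ENNReal.ofReal_le_ofReal ?_
    have := (hu n n m le_rfl hmn).le
    gcongr
  choose v hv hvn using fun n => M.exists_val_eq_of_lintegral_le
    (M.fields.sub_mem (M.val_mem (u n)) hwm) (C := (1 / 4) ^ n) (by positivity) (hfatou n)
  -- Fatou's lemma shows only `u n - w` to be square-integrable, represented by `v n`; hence `w`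
  -- enters `M.SqInt` as `u n - v n`, which does not depend on `n`.
  refine ⟨u 0 - v 0, ?_⟩
  have hval : ∀ n, u n - v n = u 0 - v 0 := fun n => by
    refine M.val_injective ?_
    rw [map_sub, map_sub, hv, hv, sub_sub_cancel, sub_sub_cancel]
  rw [tendsto_iff_norm_sub_tendsto_zero]
  refine squeeze_zero (fun n => norm_nonneg _) (g := fun n => (1 / 4 : ℝ) ^ n) (fun n => ?_)
    (tendsto_pow_atTop_nhds_zero_of_lt_one (by norm_num) (by norm_num))
  rw [← hval n, sub_sub_cancel]
  exact hvn n

instance (M : MeasurableField ν E) [∀ ζ, CompleteSpace (E ζ)] :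
    CompleteSpace M.DirectIntegral :=
  inferInstanceAs (CompleteSpace (SeparationQuotient M.SqInt))

lemma toDirectIntegral_surjective (M : MeasurableField ν E) :
    Function.Surjective M.toDirectIntegral := SeparationQuotient.surjective_mk

lemma inner_toDirectIntegral (M : MeasurableField ν E) (u v : M.SqInt) :
    inner ℝ (M.toDirectIntegral u) (M.toDirectIntegral v) = inner ℝ u v :=
  SeparationQuotient.inner_mk_mk u v

lemma toDirectIntegral_eq_of_ae_eq (M : MeasurableField ν E) {u v : M.SqInt}
    (h : ∀ᵐ ζ ∂ν, M.val u ζ = M.val v ζ) : M.toDirectIntegral u = M.toDirectIntegral v := by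
  rw [← sub_eq_zero, ← map_sub, ← norm_eq_zero, norm_toDirectIntegral, ← sq_eq_zero_iff,
    norm_sq_sqInt]
  refine integral_eq_zero_of_ae ?_
  filter_upwards [h] with ζ hζ
  simp [hζ]

/-! ### Decomposable operators -/

section Operators

variable {M : MeasurableField ν E} {A A' : M.DirectIntegral →L[ℝ] M.DirectIntegral}
  {B B' : ∀ ζ, E ζ →L[ℝ] E ζ}

lemma IsMeasurableOpField.exists_val_eq (hB : M.IsMeasurableOpField B) {C : ℝ}
    (hC : ∀ᵐ ζ ∂ν, ‖B ζ‖ ≤ C) (u : M.SqInt) :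
    ∃ v : M.SqInt, ∀ ζ, M.val v ζ = B ζ (M.val u ζ) := by
  obtain ⟨v, hv⟩ := M.exists_val_eq (hB _ (M.val_mem u)) (g := fun ζ => C ^ 2 * ‖M.val u ζ‖ ^ 2)
    (Integrable.const_mul (M.integrable_norm_sq u) _) (by
      filter_upwards [hC] with ζ hζ
      rw [← mul_pow]
      refine pow_le_pow_left₀ (norm_nonneg _) ((B ζ).le_of_opNorm_le hζ _) 2)
  exact ⟨v, congrFun hv⟩

lemma isDirectIntegralOp_id :
    M.IsDirectIntegralOp (ContinuousLinearMap.id ℝ _) fun _ => ContinuousLinearMap.id ℝ _ :=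
  ⟨fun _ hu => hu, ⟨1, ae_of_all _ fun _ => ContinuousLinearMap.norm_id_le⟩,
    fun u => ⟨u, fun _ => rfl, rfl⟩⟩

lemma IsDirectIntegralOp.add (h : M.IsDirectIntegralOp A B) (h' : M.IsDirectIntegralOp A' B') :
    M.IsDirectIntegralOp (A + A') fun ζ => B ζ + B' ζ := by
  obtain ⟨h1, ⟨C, hC⟩, h3⟩ := h
  obtain ⟨h1', ⟨C', hC'⟩, h3'⟩ := h'
  refine ⟨fun u hu => M.fields.add_mem (h1 u hu) (h1' u hu), ⟨C + C', ?_⟩, fun u => ?_⟩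
  · filter_upwards [hC, hC'] with ζ hζ hζ'
    exact (norm_add_le _ _).trans (add_le_add hζ hζ')
  · obtain ⟨v, hv, hA⟩ := h3 u
    obtain ⟨v', hv', hA'⟩ := h3' u
    exact ⟨v + v', fun ζ => by simp [hv, hv'], by simp [hA, hA']⟩

lemma IsDirectIntegralOp.smul (r : ℝ) (h : M.IsDirectIntegralOp A B) :
    M.IsDirectIntegralOp (r • A) fun ζ => r • B ζ := by
  obtain ⟨h1, ⟨C, hC⟩, h3⟩ := h
  refine ⟨fun u hu => M.fields.smul_mem r (h1 u hu), ⟨‖r‖ * C, ?_⟩, fun u => ?_⟩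
  · filter_upwards [hC] with ζ hζ
    rw [norm_smul]
    gcongr
  · obtain ⟨v, hv, hA⟩ := h3 u
    exact ⟨r • v, fun ζ => by simp [hv], by simp [hA]⟩

lemma IsDirectIntegralOp.sub (h : M.IsDirectIntegralOp A B) (h' : M.IsDirectIntegralOp A' B') :
    M.IsDirectIntegralOp (A - A') fun ζ => B ζ - B' ζ := by
  simpa [sub_eq_add_neg] using h.add (h'.smul (-1))

lemma IsDirectIntegralOp.comp (h : M.IsDirectIntegralOp A B)
    (h' : M.IsDirectIntegralOp A' B') :
    M.IsDirectIntegralOp (A.comp A') fun ζ => (B ζ).comp (B' ζ) := by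
  obtain ⟨h1, ⟨C, hC⟩, h3⟩ := h
  obtain ⟨h1', ⟨C', hC'⟩, h3'⟩ := h'
  refine ⟨fun u hu => h1 _ (h1' u hu), ⟨C * C', ?_⟩, fun u => ?_⟩
  · filter_upwards [hC, hC'] with ζ hζ hζ'
    exact ((B ζ).opNorm_comp_le (B' ζ)).trans
      (mul_le_mul hζ hζ' (norm_nonneg _) ((norm_nonneg _).trans hζ))
  · obtain ⟨v', hv', hA'⟩ := h3' u
    obtain ⟨v, hv, hA⟩ := h3 v'
    exact ⟨v, fun ζ => by simp [hv, hv'], by simp [hA, hA']⟩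

lemma IsDirectIntegralOp.pow (h : M.IsDirectIntegralOp A B) (k : ℕ) :
    M.IsDirectIntegralOp (A ^ k) fun ζ => B ζ ^ k := by
  induction k with
  | zero => exact isDirectIntegralOp_id
  | succ k ih =>
    simp only [pow_succ]
    exact ih.comp h

lemma isDirectIntegralOp_sum {A : ℕ → M.DirectIntegral →L[ℝ] M.DirectIntegral}
    {B : ℕ → ∀ ζ, E ζ →L[ℝ] E ζ} (h : ∀ k, M.IsDirectIntegralOp (A k) (B k)) (m : ℕ) :
    M.IsDirectIntegralOp (∑ k ∈ Finset.range m, A k) fun ζ => ∑ k ∈ Finset.range m, B k ζ := by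
  induction m with
  | zero => simpa using (isDirectIntegralOp_id (M := M)).smul 0
  | succ m ih => simpa only [Finset.sum_range_succ] using ih.add (h m)

/-- A strong limit of uniformly bounded decomposable operators is decomposable, if the operators
on the fibres converge strongly. -/
lemma isDirectIntegralOp_of_tendsto {A' : ℕ → M.DirectIntegral →L[ℝ] M.DirectIntegral}
    {B' : ℕ → ∀ ζ, E ζ →L[ℝ] E ζ} (h : ∀ n, M.IsDirectIntegralOp (A' n) (B' n)) {C : ℝ}
    (hC : ∀ n ζ x, ‖B' n ζ x‖ ≤ C * ‖x‖)
    (hB : ∀ ζ x, Tendsto (fun n => B' n ζ x) atTop (𝓝 (B ζ x)))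
    (hA : ∀ u, Tendsto (fun n => A' n u) atTop (𝓝 (A u))) : M.IsDirectIntegralOp A B := by
  have hm : M.IsMeasurableOpField B := fun u hu =>
    M.mem_fields_of_ae_tendsto (fun n => (h n).1 u hu) (ae_of_all _ fun ζ => hB ζ _)
  have hb : ∀ ζ x, ‖B ζ x‖ ≤ C * ‖x‖ := fun ζ x =>
    le_of_tendsto (hB ζ x).norm (Eventually.of_forall fun n => hC n ζ x)
  -- `C` may be negative if all fibres are trivial.
  have hb' : ∀ᵐ ζ ∂ν, ‖B ζ‖ ≤ max C 0 := ae_of_all _ fun ζ =>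
    (B ζ).opNorm_le_bound (le_max_right _ _) fun x => (hb ζ x).trans
      (mul_le_mul_of_nonneg_right (le_max_left _ _) (norm_nonneg _))
  refine ⟨hm, ⟨_, hb'⟩, fun u => ?_⟩
  obtain ⟨v, hv⟩ := hm.exists_val_eq hb' u
  refine ⟨v, hv, tendsto_nhds_unique (hA (M.toDirectIntegral u)) ?_⟩
  choose w hw hwA using fun n => (h n).2.2 u
  rw [tendsto_iff_norm_sub_tendsto_zero]
  -- Dominated convergence: the fibrewise difference has norm at most `2 * C * ‖u ζ‖`.
  have hsq : Tendsto (fun n => ‖w n - v‖ ^ 2) atTop (𝓝 0) := by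
    simp only [norm_sq_sqInt]
    rw [← integral_zero Z ℝ (μ := ν)]
    refine tendsto_integral_of_dominated_convergence (fun ζ => (2 * C) ^ 2 * ‖M.val u ζ‖ ^ 2)
      (fun n => ((M.aemeasurable_norm _ (M.val_mem (w n - v))).pow_const 2).aestronglyMeasurable)
      (Integrable.const_mul (M.integrable_norm_sq u) _) (fun n => ae_of_all _ fun ζ => ?_) (ae_of_all _ fun ζ => ?_)
    · rw [Real.norm_of_nonneg (sq_nonneg _), ← mul_pow, map_sub, Pi.sub_apply, hw, hv]
      refine pow_le_pow_left₀ (norm_nonneg _) ((norm_sub_le _ _).trans ?_) 2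
      linarith [hC n ζ (M.val u ζ), hb ζ (M.val u ζ)]
    · simp only [map_sub, Pi.sub_apply, hw, hv]
      simpa using (((hB ζ (M.val u ζ)).sub_const (B ζ (M.val u ζ))).norm).pow 2
  have := hsq.sqrt
  simpa [hwA, ← map_sub, norm_toDirectIntegral] using this

end Operators

end MeasurableField

/-! ### Partial sums of the exponential series -/

section Exp

variable {H : Type*} [NormedAddCommGroup H] [InnerProductSpace ℝ H]

lemma tendsto_exp_partial_sum [CompleteSpace H] (A : H →L[ℝ] H) (u : H) :
    Tendsto (fun m : ℕ => (∑ k ∈ Finset.range m, ((k.factorial : ℝ)⁻¹) • A ^ k) u) atTop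
      (𝓝 (NormedSpace.exp A u)) :=
  ((ContinuousLinearMap.apply ℝ H u).continuous.tendsto _).comp
    (NormedSpace.exp_series_hasSum_exp' (𝕂 := ℝ) A).tendsto_sum_nat

/-- The bound depends on `A` only through `C`, so it is uniform over the fibres as well as in `m`.
-/
lemma norm_exp_partial_sum_le {A : H →L[ℝ] H} {C : ℝ} (hC : 0 ≤ C)
    (hA : ∀ u, ‖A u‖ ≤ C * ‖u‖) (m : ℕ) (u : H) :
    ‖(∑ k ∈ Finset.range m, ((k.factorial : ℝ)⁻¹) • A ^ k) u‖ ≤ Real.exp C * ‖u‖ := by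
  have hpow : ∀ k : ℕ, ‖(A ^ k) u‖ ≤ C ^ k * ‖u‖ := fun k => by
    induction k with
    | zero => simp
    | succ k ih =>
      rw [pow_succ', mul_apply_eq_comp, pow_succ', mul_assoc]
      exact (hA _).trans (mul_le_mul_of_nonneg_left ih hC)
  rw [sum_apply]
  refine (norm_sum_le _ _).trans ?_
  calc ∑ k ∈ Finset.range m, ‖(((k.factorial : ℝ)⁻¹) • A ^ k) u‖
      ≤ ∑ k ∈ Finset.range m, C ^ k / k.factorial * ‖u‖ := by
        refine Finset.sum_le_sum fun k _ => ?_
        rw [smul_apply, norm_smul, norm_inv, Real.norm_natCast,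
          div_eq_inv_mul, mul_assoc]
        exact mul_le_mul_of_nonneg_left (hpow k) (by positivity)
    _ ≤ Real.exp C * ‖u‖ := by
        rw [← Finset.sum_mul]
        exact mul_le_mul_of_nonneg_right (Real.sum_le_exp_of_nonneg hC m) (norm_nonneg u)

end Exp

/-! ### Measurability of fibre resolvents, and the integrated form -/

section Fields

variable {Z : Type*} [MeasurableSpace Z] {ν : Measure Z}

lemma MeasurableField.IsDirectIntegralOp.exp {E : Z → Type*} [∀ ζ, NormedAddCommGroup (E ζ)]
    [∀ ζ, InnerProductSpace ℝ (E ζ)] [∀ ζ, CompleteSpace (E ζ)] {M : MeasurableField ν E}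
    {A : M.DirectIntegral →L[ℝ] M.DirectIntegral} {B : ∀ ζ, E ζ →L[ℝ] E ζ}
    (h : M.IsDirectIntegralOp A B) {C : ℝ} (hC : 0 ≤ C) (hB : ∀ ζ u, ‖B ζ u‖ ≤ C * ‖u‖) :
    M.IsDirectIntegralOp (NormedSpace.exp A) fun ζ => NormedSpace.exp (B ζ) :=
  isDirectIntegralOp_of_tendsto
    (fun m => isDirectIntegralOp_sum (fun k => (h.pow k).smul ((k.factorial : ℝ)⁻¹)) m)
    (fun m ζ u => norm_exp_partial_sum_le hC (hB ζ) m u)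
    (fun ζ u => tendsto_exp_partial_sum (B ζ) u) (fun u => tendsto_exp_partial_sum A u)

namespace MeasurableFormField

variable {H : Z → Type*} [∀ ζ, NormedAddCommGroup (H ζ)]
  [∀ ζ, InnerProductSpace ℝ (H ζ)] [∀ ζ, CompleteSpace (H ζ)] {q : ∀ ζ, QForm (H ζ)}

lemma isClosed_fibre (F : MeasurableFormField ν q) (ζ : Z) : (F.Q ζ).IsClosed :=
  (q ζ).closure_isClosed _

lemma isDenselyDefined_fibre (F : MeasurableFormField ν q) (ζ : Z) :
    (F.Q ζ).IsDenselyDefined :=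
  (q ζ).closure_isDenselyDefined _ (F.dense ζ)

lemma isResolvent_fibre (F : MeasurableFormField ν q) {α : ℝ} (hα : 0 < α) (ζ : Z) :
    (F.Q ζ).IsResolvent α ((F.Q ζ).resolvent α) :=
  QForm.isResolvent_resolvent (F.isClosed_fibre ζ) hα

/-- The generator equation reads `Q₁(u, v) = ⟪u - w, v⟫`, so measurability of `u - w` alone suffices
to test `u` against all of `fieldQ` and apply axiom (b) there. -/
lemma exists_mem_fields_of_isGenerator (F : MeasurableFormField ν q) {u w : ∀ ζ, H ζ}
    (h : ∀ ζ, (F.Q ζ).IsGenerator (u ζ) (w ζ)) (huw : u - w ∈ F.fieldH.fields) :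
    ∃ x ∈ F.fieldQ.fields, ∀ ζ, (F.Q ζ).incl (x ζ) = u ζ ∧
      ∀ v, (F.Q ζ).bilin (x ζ) v = inner ℝ (-w ζ) ((F.Q ζ).incl v) := by
  choose x hx hxv using fun ζ => QForm.isGenerator_iff.1 (h ζ)
  refine ⟨x, F.fieldQ.mem_of_aemeasurable_inner x fun v hv => ?_, fun ζ => ⟨hx ζ, hxv ζ⟩⟩
  refine (F.fieldH.aemeasurable_inner huw (F.le v hv)).congr (ae_of_all _ fun ζ => ?_)
  simp only [Pi.sub_apply]
  rw [QForm.inner_dom, QForm.bilin_symm, hxv, hx, real_inner_comm (u ζ), inner_sub_left,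
    inner_neg_left]
  ring

lemma isMeasurableOpField_resolvent_one (F : MeasurableFormField ν q) :
    F.fieldH.IsMeasurableOpField fun ζ => (F.Q ζ).resolvent 1 := by
  intro u hu
  obtain ⟨x, hx, hxu⟩ := F.exists_mem_fields_of_isGenerator
    (fun ζ => (F.isResolvent_fibre one_pos ζ).1 (u ζ))
    -- For `α = 1`, `u - w` is the given field; for other `α` it would involve the resolvent itself.
    (by
      refine (congrArg (· ∈ F.fieldH.fields) (funext fun ζ => ?_)).mpr hu
      simp)
  refine (congrArg (· ∈ F.fieldH.fields) (funext fun ζ => ?_)).mp (F.le x hx)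
  exact (hxu ζ).1

/-- The iteration of the Neumann series of `G_α` around `G_β`. -/
lemma isMeasurableOpField_resolvent_of_lt (F : MeasurableFormField ν q) {α β : ℝ} (hα : 0 < α)
    (hαβ : α < 2 * β) (h : F.fieldH.IsMeasurableOpField fun ζ => (F.Q ζ).resolvent β) :
    F.fieldH.IsMeasurableOpField fun ζ => (F.Q ζ).resolvent α := by
  intro u hu
  have hβ : 0 < β := by linarith
  -- `G_α u` is the fixed point of `x ↦ G_β (u + (β - α) x)`, a contraction with factor `|β - α| /
  -- β`, which is below `1` because `0 < α < 2 β`. The iteration starts at `0`.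
  let v : ℕ → ∀ ζ, H ζ := fun n => Nat.rec 0
    (fun _ x ζ => (F.Q ζ).resolvent β (u ζ + (β - α) • x ζ)) n
  have hv : ∀ n, v n ∈ F.fieldH.fields := fun n => by
    induction n with
    | zero => exact F.fieldH.fields.zero_mem
    | succ n ih => exact h _ (F.fieldH.fields.add_mem hu (F.fieldH.fields.smul_mem (β - α) ih))
  refine F.fieldH.mem_fields_of_ae_tendsto hv (ae_of_all _ fun ζ => ?_)
  have hGα := F.isResolvent_fibre hα ζ
  have hGβ := F.isResolvent_fibre hβ ζ
  set y := (F.Q ζ).resolvent α (u ζ) with hy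
  have hfix : (F.Q ζ).resolvent β (u ζ + (β - α) • y) = y := by
    refine hGβ.eq_of_isGenerator ?_
    have := hGα.1 (u ζ)
    rw [← hy] at this
    convert this using 1
    rw [sub_smul]
    abel
  set r := |β - α| / β with hr
  have hr0 : 0 ≤ r := by positivity
  have hr1 : r < 1 := by
    rw [hr, div_lt_one hβ, abs_lt]
    constructor <;> linarith
  have hbound : ∀ n, ‖v n ζ - y‖ ≤ r ^ n * ‖y‖ := fun n => by
    induction n with
    | zero => simp [v]
    | succ n ih =>
      have h1 : v (n + 1) ζ - y = (F.Q ζ).resolvent β ((β - α) • (v n ζ - y)) := by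
        change (F.Q ζ).resolvent β (u ζ + (β - α) • v n ζ) - y = _
        nth_rw 1 [← hfix]
        rw [← map_sub, add_sub_add_left_eq_sub, smul_sub]
      have h2 := hGβ.mul_norm_le ((β - α) • (v n ζ - y))
      rw [← h1, norm_smul, Real.norm_eq_abs] at h2
      have h3 : ‖v (n + 1) ζ - y‖ ≤ r * ‖v n ζ - y‖ := by
        rw [hr, div_mul_eq_mul_div, le_div_iff₀ hβ]
        linarith
      rw [pow_succ', mul_assoc]
      exact h3.trans (mul_le_mul_of_nonneg_left ih hr0)
  rw [tendsto_iff_norm_sub_tendsto_zero]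
  refine squeeze_zero (fun n => norm_nonneg _) hbound ?_
  simpa using (tendsto_pow_atTop_nhds_zero_of_lt_one hr0 hr1).mul_const ‖y‖

lemma isMeasurableOpField_resolvent (F : MeasurableFormField ν q) {α : ℝ} (hα : 0 < α) :
    F.fieldH.IsMeasurableOpField fun ζ => (F.Q ζ).resolvent α := by
  -- Any ratio strictly between `1` and `2` would do: each step satisfies `α < 2 β`, and the powers
  -- exceed any given `α`.
  have h : ∀ n : ℕ, F.fieldH.IsMeasurableOpField fun ζ => (F.Q ζ).resolvent ((3 / 2) ^ n) := by
    intro n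
    induction n with
    | zero => simpa using F.isMeasurableOpField_resolvent_one
    | succ n ih =>
      refine F.isMeasurableOpField_resolvent_of_lt (by positivity) ?_ ih
      rw [pow_succ]
      have : (0 : ℝ) < (3 / 2) ^ n := by positivity
      linarith
  obtain ⟨n, hn⟩ := pow_unbounded_of_one_lt α (by norm_num : (1 : ℝ) < 3 / 2)
  exact F.isMeasurableOpField_resolvent_of_lt hα (by linarith) (h n)

/-- The generator of the direct integral acts fibrewise. -/
lemma isGenerator_directIntegral (F : MeasurableFormField ν q) {u w : F.fieldH.SqInt}
    (h : ∀ ζ, (F.Q ζ).IsGenerator (F.fieldH.val u ζ) (F.fieldH.val w ζ)) :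
    F.directIntegral.IsGenerator (F.fieldH.toDirectIntegral u) (F.fieldH.toDirectIntegral w) := by
  obtain ⟨x, hx, hxu⟩ := F.exists_mem_fields_of_isGenerator h
    (by rw [← map_sub]; exact F.fieldH.val_mem (u - w))
  -- Testing the generator equation with `u` itself gives `Q_{ζ,1}(u, u) = ⟪u - w, u⟫`, which is
  -- integrable.
  obtain ⟨x', hx'⟩ := F.fieldQ.exists_val_eq hx (F.fieldH.integrable_inner (u - w) u)
    (ae_of_all _ fun ζ => le_of_eq (by
      rw [QForm.norm_sq_dom, (hxu ζ).2, (hxu ζ).1, map_sub, Pi.sub_apply, inner_sub_left,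
        inner_neg_left, real_inner_self_eq_norm_sq]
      ring))
  have hincl : F.inclSqInt x' = u := F.fieldH.val_injective (funext fun ζ => by
    rw [val_inclSqInt, hx', (hxu ζ).1])
  have hmem : F.fieldH.toDirectIntegral u ∈ F.domain := ⟨x', by
    rw [LinearMap.comp_apply, hincl]⟩
  refine ⟨hmem, fun v => ?_⟩
  have hrep := F.ae_eq_rep (u := ⟨_, hmem⟩) (w := x') (by rw [hincl])
  change ∫ ζ, (F.Q ζ).bilin (F.fieldQ.val (F.rep ⟨_, hmem⟩) ζ) (F.fieldQ.val (F.rep v) ζ) ∂ν = _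
  rw [← F.rep_spec v, ← map_neg, MeasurableField.inner_toDirectIntegral,
    MeasurableField.inner_sqInt]
  refine integral_congr_ae ?_
  filter_upwards [hrep] with ζ hζ
  rw [hζ, hx', (hxu ζ).2, map_neg, Pi.neg_apply, val_inclSqInt]

lemma norm_resolvent_fibre_le (F : MeasurableFormField ν q) {α : ℝ} (hα : 0 < α) (ζ : Z) :
    ‖(F.Q ζ).resolvent α‖ ≤ α⁻¹ := by
  refine ContinuousLinearMap.opNorm_le_bound _ (by positivity) fun u => ?_
  rw [inv_mul_eq_div, le_div_iff₀ hα, mul_comm]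
  exact (F.isResolvent_fibre hα ζ).mul_norm_le u

/-- Solves the integrated resolvent equation explicitly, without density or closedness of the
integrated form; it serves both the proof of density and the identification of `G_α`. -/
lemma exists_resolvent_val (F : MeasurableFormField ν q) {α : ℝ} (hα : 0 < α)
    (u : F.fieldH.SqInt) :
    ∃ v : F.fieldH.SqInt, (∀ ζ, F.fieldH.val v ζ = (F.Q ζ).resolvent α (F.fieldH.val u ζ)) ∧
      F.directIntegral.IsGenerator (F.fieldH.toDirectIntegral v)
        (α • F.fieldH.toDirectIntegral v - F.fieldH.toDirectIntegral u) := by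
  obtain ⟨v, hv⟩ := (F.isMeasurableOpField_resolvent hα).exists_val_eq
    (ae_of_all _ (F.norm_resolvent_fibre_le hα)) u
  refine ⟨v, hv, ?_⟩
  rw [← map_smul, ← map_sub]
  refine F.isGenerator_directIntegral fun ζ => ?_
  simpa [hv] using (F.isResolvent_fibre hα ζ).1 (F.fieldH.val u ζ)

lemma isDenselyDefined_directIntegral (F : MeasurableFormField ν q) :
    F.directIntegral.IsDenselyDefined := by
  change Dense (F.domain : Set F.fieldH.DirectIntegral)
  rw [Submodule.dense_iff_topologicalClosure_eq_top, Submodule.topologicalClosure_eq_top_iff,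
    Submodule.eq_bot_iff]
  intro f hf
  rw [Submodule.mem_orthogonal] at hf
  obtain ⟨u, rfl⟩ := F.fieldH.toDirectIntegral_surjective f
  obtain ⟨v, hv, hgen⟩ := F.exists_resolvent_val one_pos u
  have h0 := hf _ hgen.choose
  rw [MeasurableField.inner_toDirectIntegral, MeasurableField.inner_sqInt] at h0
  have hpos : ∀ ζ, ‖F.fieldH.val v ζ‖ ^ 2 ≤ inner ℝ (F.fieldH.val v ζ) (F.fieldH.val u ζ) := by
    intro ζ
    have := ((F.isResolvent_fibre one_pos ζ).1 (F.fieldH.val u ζ)).inner_nonpos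
    rw [← hv, one_smul, inner_sub_left, real_inner_self_eq_norm_sq, real_inner_comm] at this
    linarith
  rw [integral_eq_zero_iff_of_nonneg (fun ζ => (sq_nonneg _).trans (hpos ζ))
    (F.fieldH.integrable_inner v u)] at h0
  rw [← map_zero F.fieldH.toDirectIntegral]
  refine F.fieldH.toDirectIntegral_eq_of_ae_eq ?_
  filter_upwards [h0] with ζ hζ
  have hv0 : F.fieldH.val v ζ = 0 := by
    have := (hpos ζ).trans_eq hζ
    exact norm_eq_zero.1 (pow_eq_zero_iff two_ne_zero |>.1 (le_antisymm this (sq_nonneg _)))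
  have hg := (F.isResolvent_fibre one_pos ζ).1 (F.fieldH.val u ζ)
  rw [← hv, hv0] at hg
  obtain ⟨x, hx, hxv⟩ := QForm.isGenerator_iff.1 hg
  have hx0 : x = 0 := (F.Q ζ).incl_injective (by rw [hx, map_zero])
  rw [map_zero]
  refine QForm.eq_zero_of_inner_incl (F.isDenselyDefined_fibre ζ) fun w => ?_
  simpa [hx0] using (hxv w).symm

/-- The class map from the complete space `F.fieldQ.SqInt` onto the domain preserves the
(semi)norms, since the chosen representatives agree almost everywhere with any other. -/
lemma isClosed_directIntegral (F : MeasurableFormField ν q) : F.directIntegral.IsClosed := by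
  have hcomp : ∀ ζ, CompleteSpace (F.Q ζ).Dom := F.isClosed_fibre
  let e : F.fieldQ.SqInt →ₗ[ℝ] F.directIntegral.Dom :=
    (F.fieldH.toDirectIntegral ∘ₗ F.inclSqInt).rangeRestrict
  have hincl : ∀ x, F.directIntegral.incl (e x) = F.fieldH.toDirectIntegral (F.inclSqInt x) :=
    fun _ => rfl
  have hnorm : ∀ x, ‖e x‖ = ‖x‖ := fun x => by
    rw [← sq_eq_sq₀ (norm_nonneg _) (norm_nonneg _), QForm.norm_sq_dom, hincl,
      MeasurableField.norm_toDirectIntegral, MeasurableField.norm_sq_sqInt,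
      MeasurableField.norm_sq_sqInt]
    let y : F.domain := (F.fieldH.toDirectIntegral ∘ₗ F.inclSqInt).rangeRestrict x
    have hrep := F.ae_eq_rep (u := y) (w := x) rfl
    have h1 : F.directIntegral.bilin (e x) (e x) =
        ∫ ζ, (F.Q ζ).bilin (F.fieldQ.val x ζ) (F.fieldQ.val x ζ) ∂ν := by
      change ∫ ζ, (F.Q ζ).bilin (F.fieldQ.val (F.rep y) ζ) (F.fieldQ.val (F.rep y) ζ) ∂ν = _
      refine integral_congr_ae ?_
      filter_upwards [hrep] with ζ hζ
      rw [hζ]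
    rw [h1, ← integral_add (F.integrable_bilin x x)
      (F.fieldH.integrable_norm_sq (F.inclSqInt x))]
    refine integral_congr_ae (ae_of_all _ fun ζ => ?_)
    simp only [QForm.norm_sq_dom, val_inclSqInt]
  have hi : Isometry e := AddMonoidHomClass.isometry_of_norm e hnorm
  exact (hi.isUniformInducing.completeSpace_congr
    (LinearMap.surjective_rangeRestrict _)).1 inferInstance

lemma isDirectIntegralOp_resolvent (F : MeasurableFormField ν q) {α : ℝ} (hα : 0 < α) :
    F.fieldH.IsDirectIntegralOp (F.directIntegral.resolvent α)
      fun ζ => (F.Q ζ).resolvent α := by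
  refine ⟨F.isMeasurableOpField_resolvent hα,
    ⟨α⁻¹, ae_of_all _ (F.norm_resolvent_fibre_le hα)⟩, fun u => ?_⟩
  obtain ⟨v, hv, hgen⟩ := F.exists_resolvent_val hα u
  exact ⟨v, hv, (QForm.isResolvent_resolvent F.isClosed_directIntegral hα).eq_of_isGenerator hgen⟩

lemma isDirectIntegralOp_exp_yosida (F : MeasurableFormField ν q) {α t : ℝ} (hα : 0 < α)
    (ht : 0 ≤ t) :
    F.fieldH.IsDirectIntegralOp (NormedSpace.exp (t • F.directIntegral.yosida α))
      fun ζ => NormedSpace.exp (t • (F.Q ζ).yosida α) := by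
  have h : F.fieldH.IsDirectIntegralOp (F.directIntegral.yosida α)
      fun ζ => (F.Q ζ).yosida α :=
    (((F.isDirectIntegralOp_resolvent hα).smul α).sub
      MeasurableField.isDirectIntegralOp_id).smul α
  -- `‖α G_α u - u‖ ≤ 2 ‖u‖` in every fibre.
  refine (h.smul t).exp (C := t * (α * 2)) (by positivity) fun ζ u => ?_
  rw [smul_apply, QForm.yosida_apply, norm_smul, norm_smul,
    Real.norm_of_nonneg ht, Real.norm_of_nonneg hα.le, mul_assoc, mul_assoc]
  have h1 := norm_sub_le (α • (F.Q ζ).resolvent α u) u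
  have h2 := QForm.norm_smul_resolvent_le (F.isClosed_fibre ζ) hα u
  gcongr
  linarith

/-- The Yosida exponentials converge strongly both in each fibre and on the direct integral, and
they are fibrewise contractions, which gives the uniform bound `C = 1`. -/
lemma isDirectIntegralOp_semigroup (F : MeasurableFormField ν q) (t : ℝ≥0) :
    F.fieldH.IsDirectIntegralOp (F.directIntegral.semigroup t)
      fun ζ => (F.Q ζ).semigroup t :=
  MeasurableField.isDirectIntegralOp_of_tendsto
    (fun n : ℕ => F.isDirectIntegralOp_exp_yosida (α := n + 1) (by positivity) t.2) (C := 1)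
    (fun n ζ u => by
      rw [one_mul]
      exact norm_exp_smul_apply_le
        (QForm.yosida_inner_nonpos (F.isClosed_fibre ζ) (by positivity)) t.2 u)
    (fun ζ => QForm.tendsto_semigroup (F.isClosed_fibre ζ) (F.isDenselyDefined_fibre ζ) t)
    (QForm.tendsto_semigroup F.isClosed_directIntegral F.isDenselyDefined_directIntegral t)

end MeasurableFormField

end Fields

end DirInt

theorem proposition2p7 {Z : Type*} [MeasurableSpace Z] [MeasurableSpace.CountablyGenerated Z]
    (ν : MeasureTheory.Measure Z) [MeasureTheory.SigmaFinite ν]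
    {H : Z → Type*} [∀ ζ, NormedAddCommGroup (H ζ)] [∀ ζ, InnerProductSpace ℝ (H ζ)]
    [∀ ζ, CompleteSpace (H ζ)]
    (q : ∀ ζ, DirInt.QForm (H ζ)) (F : DirInt.MeasurableFormField ν q) :
    -- the underlying space is a Hilbert space, on which the form is densely defined and closed
    CompleteSpace F.fieldH.DirectIntegral ∧
    F.directIntegral.IsDenselyDefined ∧ F.directIntegral.IsClosed ∧
    -- the fibrewise resolvents and semigroups exist and are measurable fields of operators
    (∀ α : ℝ, 0 < α →
      (∀ ζ, (F.Q ζ).IsResolvent α ((F.Q ζ).resolvent α)) ∧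
      F.fieldH.IsMeasurableOpField (fun ζ => (F.Q ζ).resolvent α)) ∧
    (∀ ζ, (F.Q ζ).IsSemigroup (F.Q ζ).semigroup) ∧
    (∀ t : ℝ≥0, 0 < t → F.fieldH.IsMeasurableOpField (fun ζ => (F.Q ζ).semigroup t)) ∧
    -- the resolvent and the semigroup of the integrated form exist and are the direct integrals
    (∀ α : ℝ, 0 < α →
      F.directIntegral.IsResolvent α (F.directIntegral.resolvent α) ∧
      F.fieldH.IsDirectIntegralOp (F.directIntegral.resolvent α)
        (fun ζ => (F.Q ζ).resolvent α)) ∧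
    F.directIntegral.IsSemigroup F.directIntegral.semigroup ∧
    (∀ t : ℝ≥0, 0 < t →
      F.fieldH.IsDirectIntegralOp (F.directIntegral.semigroup t)
        (fun ζ => (F.Q ζ).semigroup t)) := by
  refine ⟨inferInstance, F.isDenselyDefined_directIntegral, F.isClosed_directIntegral,
    fun α hα => ⟨F.isResolvent_fibre hα, F.isMeasurableOpField_resolvent hα⟩,
    fun ζ => DirInt.QForm.isSemigroup_semigroup (F.isClosed_fibre ζ) (F.isDenselyDefined_fibre ζ),
    fun t _ => (F.isDirectIntegralOp_semigroup t).1,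
    fun α hα => ⟨DirInt.QForm.isResolvent_resolvent F.isClosed_directIntegral hα,
      F.isDirectIntegralOp_resolvent hα⟩,
    DirInt.QForm.isSemigroup_semigroup F.isClosed_directIntegral
      F.isDenselyDefined_directIntegral,
    fun t _ => F.isDirectIntegralOp_semigroup t⟩
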